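/- **Setting.** Consider $N\ge 1$ qubits in a chain, with Pauli matrices $\sigma_l^u$ ($u\in\{x,y,z\}$) on qubit $l$, and a Hamiltonian $H(t)$ of period $1$ that is time-independent on each piece of a partition of $[0,1)$. The initial state is a Haar-random product state $|\psi(0)\rangle=\bigotimes_{l=1}^N|\phi_l\rangle$, where the $|\phi_l\rangle$ are independent and uniformly distributed on the unit sphere of $\mathbb C^2$, and $|\psi(t)\rangle=\mathcal Te^{-i\int_0^tH(\tau)\,\mathrm d\tau}|\psi(0)\rangle$. **Families.** (a) Parameters $\mathbf x=(h_l^x,h_l^z,J_l)\in\mathbb R^{3N-1}$, with $H(t)=\sum_{l=1}^Nh_l^z\sigma_l^z+\sum_{l=1}^{N-1}J_l\sigma_l^z\sigma_{l+1}^z$ for $0\le t<1/2$ and $H(t)=\sum_{l=1}^Nh_l^x\sigma_l^x$ for $1/2\le t<1$. (b) For each $n\ge1$, $0=t_0<t_1<\dots<t_n=1$, $\alpha\in\{0,1\}^{3n}$ and $\gamma\in\{0,1\}^{9n}$ with $\alpha_1^x=\alpha_1^z=\gamma_1^{zz}=1$: parameters $\mathbf x=(h_{j,l}^u,J_{j,l}^{u,v})\in\mathbb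 R^{12nN-9n}$, with $H(t)=\sum_{l=1}^N\sum_u\alpha_j^uh_{j,l}^u\sigma_l^u+\sum_{l=1}^{N-1}\sum_{u,v}\gamma_j^{u,v}J_{j,l}^{u,v}\sigma_l^u\sigma_{l+1}^v$ for $t_{j-1}\le t<t_j$. **Approximate periodicity.** A function $f:\mathbb R\to\mathbb R$ is $\epsilon$-periodic with period $1$ if there is $\bar f:[0,1)\to\mathbb R$ with $$\liminf_{M\to\infty}\frac1M\Big|\Big\{m\in\{0,\dots,M-1\}:\int_0^1|f(m+x)-\bar f(x)|^2\,\mathrm dx\le\epsilon\Big\}\Big|\ge1-\epsilon .$$ It is $\epsilon$-periodic with period $p$ if $t\mapsto f(pt)$ is $\epsilon$-periodic with period $1$. It is time-crystalline at accuracy $\epsilon$ if it is not $\epsilon$-periodic with period $1$ but is $\epsilon$-periodic with period $p$ for some integer $p>1$. **Discrete time crystal (DTC).** For $c>0$, the system at $\mathbf x$ shows DTC behaviour at the longest time scales (at resolution $e^{-cN}$) if there are a Hermitian operator $A$ with $\|A\|=1$ and some $\epsilon\ge e^{-cN}$ such that, with probability greater than $e^{-cN}$ over $|\psi(0)\rangle$,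 the function $t\mapsto\langle\psi(t)|A|\psi(t)\rangle$ is time-crystalline at accuracy $\epsilon$. (Probability means outer probability if the event is not measurable.) **Stability.** A property of the systems in a family is stable at $\mathbf x_0$ with perturbation strength $r$ if it holds at every $\mathbf x$ within Euclidean distance $r$ of $\mathbf x_0$ for which $H_{\mathbf x}(t)-H_{\mathbf x_0}(t)$ has period $1$ in $t$. It is unstable at $\mathbf x_0$ under infinitesimal period-$1$ perturbations if it is stable at $\mathbf x_0$ with no strength $r>0$. **Statement.** There is an absolute constant $c>0$ such that for the family (a), and for every family in (b), at every finite size $N\ge1$: the set of parameters at which DTC behaviour at the longest time scales (at resolution $e^{-cN}$) occurs has Lebesgue measure zero, and this behaviour is unstable at every parameter point $\mathbf x_0$ under infinitesimal period-$1$ perturbations. -/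

import Mathlib

open MeasureTheory Filter

noncomputable section

namespace Floquet

/-! ### The chain of `N` qubits -/

/-- Computational basis labels of `N` qubits; the Hilbert space `(ℂ²)^{⊗N}` is the space of
functions `Config N → ℂ`. -/
abbrev Config (N : ℕ) : Type := Fin N → Fin 2

/-- Operators on the Hilbert space of `N` qubits. -/
abbrev Op (N : ℕ) : Type := Matrix (Config N) (Config N) ℂ

/-- The three directions of the Pauli matrices. -/
inductive Axis : Type
  | x
  | y
  | z
  deriving DecidableEq

instance : Fintype Axis := ⟨{Axis.x, Axis.y, Axis.z}, by intro a; cases a <;> simp⟩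

/-- The Pauli matrices. -/
def pauli : Axis → Matrix (Fin 2) (Fin 2) ℂ
  | Axis.x => !![0, 1; 1, 0]
  | Axis.y => !![0, -Complex.I; Complex.I, 0]
  | Axis.z => !![1, 0; 0, -1]

/-- The Pauli matrix `σ_l^u`, acting on qubit `l` and as the identity on all other qubits. -/
def siteOp {N : ℕ} (l : Fin N) (u : Axis) : Op N :=
  fun s s' => if ∀ k, k ≠ l → s k = s' k then pauli u (s l) (s' l) else 0

/-- Left end of the bond `l` of an open chain. -/
def bondLeft {N : ℕ} (l : Fin (N - 1)) : Fin N := ⟨l.1, by have := l.2; omega⟩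

/-- Right end of the bond `l` of an open chain. -/
def bondRight {N : ℕ} (l : Fin (N - 1)) : Fin N := ⟨l.1 + 1, by have := l.2; omega⟩

/-! ### Piecewise time-independent Floquet systems -/

/-- Switching times `0 = t_0 < t_1 < ⋯ < t_n = 1` (this forces `n ≥ 1`). -/
structure Schedule (n : ℕ) where
  t : Fin (n + 1) → ℝ
  strictMono : StrictMono t
  zero : t 0 = 0
  last : t (Fin.last n) = 1

variable {n N : ℕ}

/-- The Hamiltonian `H(t)` of period `1` that equals `H j` on the `j`-th piece of each period. -/
def hamiltonian (T : Schedule n) (H : Fin n → Op N) (t : ℝ) : Op N :=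
  ∑ j : Fin n,
    if T.t j.castSucc ≤ Int.fract t ∧ Int.fract t < T.t j.succ then H j else 0

/-- The time that the interval `[0, x]` spends in the `j`-th piece of the first period. -/
def duration (T : Schedule n) (j : Fin n) (x : ℝ) : ℝ :=
  max 0 (min x (T.t j.succ) - T.t j.castSucc)

/-- The time-ordered exponential `U(0, x)` for `0 ≤ x ≤ 1`; later pieces stand on the left. -/
def evolveWithin (T : Schedule n) (H : Fin n → Op N) (x : ℝ) : Op N :=
  (List.ofFn fun j : Fin n =>
    NormedSpace.exp ((-Complex.I * (duration T j x : ℂ)) • H j)).reverse.prod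

/-- The Floquet operator `U(0, 1)`. -/
def floquetOp (T : Schedule n) (H : Fin n → Op N) : Op N := evolveWithin T H 1

/-- The time-evolution operator `U(0, t)` for `t ≥ 0`. -/
def evolve (T : Schedule n) (H : Fin n → Op N) (t : ℝ) : Op N :=
  evolveWithin T H (Int.fract t) * floquetOp T H ^ ⌊t⌋₊

/-! ### Haar-random product states -/

/-- Unit vectors of `ℂ²`. -/
abbrev QubitState : Type := Metric.sphere (0 : EuclideanSpace ℂ (Fin 2)) 1

/-- The uniform probability measure on the unit sphere of `ℂ²`. -/
def haarQubit : Measure QubitState :=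
  ((volume : Measure (EuclideanSpace ℂ (Fin 2))).toSphere Set.univ)⁻¹ •
    (volume : Measure (EuclideanSpace ℂ (Fin 2))).toSphere

/-- The law of `N` independent Haar-random qubit states. -/
def haarProduct (N : ℕ) : Measure (Fin N → QubitState) :=
  Measure.pi fun _ => haarQubit

/-- The product state `⨂_l φ_l`. -/
def productState (φ : Fin N → QubitState) : Config N → ℂ :=
  fun s => ∏ l, (φ l : EuclideanSpace ℂ (Fin 2)) (s l)

/-- `⟨ψ(t)| A |ψ(t)⟩` with `|ψ(t)⟩ = U(0, t) ⨂_l φ_l`. -/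
def expectation (T : Schedule n) (H : Fin n → Op N) (A : Op N) (φ : Fin N → QubitState)
    (t : ℝ) : ℝ :=
  let ψ : Config N → ℂ := (evolve T H t).mulVec (productState φ)
  (star ψ ⬝ᵥ A.mulVec ψ).re

/-! ### Approximate periodicity and discrete time crystals -/

/-- In the period `[m, m + 1)` the function `f` is within squared `L²` distance `ε` of `g`. -/
def GoodPeriod (f g : ℝ → ℝ) (ε : ℝ) (m : ℕ) : Prop :=
  IntegrableOn (fun x : ℝ => |f (m + x) - g x| ^ 2) (Set.Ico 0 1) ∧
    ∫ x in Set.Ico (0 : ℝ) 1, |f (m + x) - g x| ^ 2 ≤ ε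

open Classical in
/-- `f` is `ε`-periodic with period `1`; only the values of `g` on `[0, 1)` matter. -/
def IsApproxPeriodic (ε : ℝ) (f : ℝ → ℝ) : Prop :=
  ∃ g : ℝ → ℝ,
    1 - ε ≤ liminf
      (fun M : ℕ => (((Finset.range M).filter fun m => GoodPeriod f g ε m).card : ℝ) / (M : ℝ))
      atTop

/-- `f` is `ε`-periodic with period `p`: it is `ε`-periodic with period `1` when time is measured
in units of `p`. -/
def IsApproxPeriodicWith (p : ℕ) (ε : ℝ) (f : ℝ → ℝ) : Prop :=
  IsApproxPeriodic ε fun t => f (p * t)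

/-- At accuracy `ε` and for all of the infinite future, `f` does not have the time-translation
symmetry `t ↦ t + 1` but has the smaller symmetry `t ↦ t + p` for some integer `p > 1`. -/
def IsTimeCrystalline (ε : ℝ) (f : ℝ → ℝ) : Prop :=
  ¬ IsApproxPeriodicWith 1 ε f ∧ ∃ p : ℕ, 1 < p ∧ IsApproxPeriodicWith p ε f

/-- Discrete time-crystalline behaviour at the longest time scale, resolved up to `e^{-cN}`: for
some observable of operator norm `1` and some accuracy `ε ≥ e^{-cN}`, the expectation value is
time-crystalline with probability more than `e^{-cN}` over Haar-random product initial states. -/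
def HasDTC (c : ℝ) (T : Schedule n) (H : Fin n → Op N) : Prop :=
  ∃ A : Op N, A.IsHermitian ∧ ‖Matrix.toEuclideanCLM (n := Config N) (𝕜 := ℂ) A‖ = 1 ∧
    ∃ ε : ℝ, Real.exp (-c * N) ≤ ε ∧
      ENNReal.ofReal (Real.exp (-c * N)) <
        haarProduct N {φ | IsTimeCrystalline ε (expectation T H A φ)}

/-! ### Stability in a parametrized family -/

/-- In a family `Ham x` of time-dependent Hamiltonians, the property `P` is stable at `x₀` with
strength `r` under perturbations of period `1`. -/
def StableAt {κ : Type} [Fintype κ] (Ham : EuclideanSpace ℝ κ → ℝ → Op N)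
    (P : EuclideanSpace ℝ κ → Prop) (x₀ : EuclideanSpace ℝ κ) (r : ℝ) : Prop :=
  ∀ x : EuclideanSpace ℝ κ, dist x x₀ ≤ r →
    Function.Periodic (fun t => Ham x t - Ham x₀ t) 1 → P x

/-- `P` is unstable at `x₀` under infinitesimal perturbations of period `1`. -/
def UnstableAt {κ : Type} [Fintype κ] (Ham : EuclideanSpace ℝ κ → ℝ → Op N)
    (P : EuclideanSpace ℝ κ → Prop) (x₀ : EuclideanSpace ℝ κ) : Prop :=
  ∀ r : ℝ, 0 < r → ¬ StableAt Ham P x₀ r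

/-! ### The kicked Ising chain -/

/-- Labels of the `3N - 1` parameters `h_l^x`, `h_l^z`, `J_l`. -/
abbrev IsingIdx (N : ℕ) : Type := (Fin N ⊕ Fin N) ⊕ Fin (N - 1)

/-- Two pieces, `[0, 1/2)` and `[1/2, 1)`. -/
def halves : Schedule 2 where
  t := ![0, 1 / 2, 1]
  strictMono := by
    intro i j hij
    fin_cases i <;> fin_cases j <;> (simp_all; try norm_num)
  zero := rfl
  last := rfl

/-- `Σ h_l^z σ_l^z + Σ J_l σ_l^z σ_{l+1}^z` in the first half, `Σ h_l^x σ_l^x` in the second. -/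
def isingPieces (N : ℕ) (x : EuclideanSpace ℝ (IsingIdx N)) : Fin 2 → Op N :=
  ![∑ l : Fin N, (x (Sum.inl (Sum.inr l)) : ℂ) • siteOp l Axis.z +
      ∑ l : Fin (N - 1), (x (Sum.inr l) : ℂ) •
        (siteOp (bondLeft l) Axis.z * siteOp (bondRight l) Axis.z),
    ∑ l : Fin N, (x (Sum.inl (Sum.inl l)) : ℂ) • siteOp l Axis.x]

/-! ### General nearest-neighbour ensembles -/

/-- Labels of the `12nN - 9n` parameters `h_{j,l}^u` and `J_{j,l}^{u,v}`. -/
abbrev ChainIdx (n N : ℕ) : Type :=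
  (Fin n × Fin N × Axis) ⊕ (Fin n × Fin (N - 1) × Axis × Axis)

/-- The pieces `H_j` of the ensemble with on-site terms selected by `α` and nearest-neighbour terms
selected by `γ`. -/
def chainPieces (N : ℕ) (α : Fin n → Axis → Bool) (γ : Fin n → Axis → Axis → Bool)
    (x : EuclideanSpace ℝ (ChainIdx n N)) (j : Fin n) : Op N :=
  ∑ l : Fin N, ∑ u : Axis,
      (if α j u then (x (Sum.inl (j, l, u)) : ℂ) else 0) • siteOp l u +
    ∑ l : Fin (N - 1), ∑ u : Axis, ∑ v : Axis,
      (if γ j u v then (x (Sum.inr (j, l, u, v)) : ℂ) else 0) •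
        (siteOp (bondLeft l) u * siteOp (bondRight l) v)

end Floquet

end

/-! Two facts combine.

Nondegenerate gaps exclude time crystals. Suppose products of two eigenvalues `z` of the Floquet
operator determine the unordered pair. In an eigenbasis the signal at time `m + x` is the sum of
`conj c_k * B_kl(x) * c_l * (conj z_k * z_l)^m`. The diagonal terms have period 1, and the
off-diagonal frequencies are pairwise distinct, so the time average of the squared remainder is at
most the sum of `|c_k|² |B_kl|² |c_l|²` over `k ≠ l`, hence at most the participation ratio `∑
|c_k|⁴`, since `B` is a contraction. If this is at most `ε²`, Markov's inequality in time gives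
`ε`-periodicity with period 1 (`isApproxPeriodic_of_nondegenerate_gaps`). For Haar-random product
states the mean participation ratio is at most `(2/3)^N` (`integral_participation_le`), and Markov's
inequality over initial states leaves an exceptional probability of at most `e^{-cN}` when `3c = log
(3/2)` (`not_hasDTC_of_gapNondegenerate`).

Nondegenerate gaps are generic. On unitary matrices the condition is the nonvanishing of a
polynomial in the entries, which are analytic in the parameters, so it fails only on a null set
unless it fails everywhere (`exists_polynomial_gapNondegenerate`, `measure_zeros_eq_zero`). A good
point is found near zero parameters: there `U = 1 - i s M + o(s)` with `M` the period-averaged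
Hamiltonian, and distinct pair sums of eigenvalues of `M` suffice
(`exists_gapNondegenerate_of_hasDerivAt`). Such an `M` is an Ising chain with a hierarchy of
couplings, built one site at a time by strong-coupling limits (`SumNondegenerate.of_pinching`,
`exists_chain_register_sumNondegenerate`).

Instability follows because a ball of positive radius does not fit into a null set. -/

namespace Floquet

open Matrix Topology

/-! ### Nondegenerate pair sums -/

/-- The sums `E a + E b` determine the unordered pair `{a, b}`. -/
def PairDistinct {ι R : Type*} [Add R] (E : ι → R) : Prop :=
  ∀ a b c d, E a + E b = E c + E d → (a = c ∧ b = d) ∨ (a = d ∧ b = c)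

/-- In every orthonormal eigenbasis of `M`, the eigenvalues have distinct pair sums. -/
def SumNondegenerate {ι : Type*} [Fintype ι] [DecidableEq ι] (M : Matrix ι ι ℂ) : Prop :=
  ∀ V ∈ unitaryGroup ι ℂ, ∀ E : ι → ℂ, M * V = V * diagonal E → PairDistinct E

/-- In every orthonormal eigenbasis of `U`, the eigenvalues have distinct pair products; for
unitary `U`, these are the nondegenerate quasi-energy gaps. -/
def GapNondegenerate {ι : Type*} [Fintype ι] [DecidableEq ι] (U : Matrix ι ι ℂ) : Prop :=
  ∀ V ∈ unitaryGroup ι ℂ, ∀ z : ι → ℂ, U * V = V * diagonal z →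
    ∀ a b c d, z a * z b = z c * z d → (a = c ∧ b = d) ∨ (a = d ∧ b = c)

/-! ### Limits of eigenbases -/

section Compactness

variable {ι : Type*} [Fintype ι] [DecidableEq ι]

theorem isClosed_unitaryGroup : IsClosed {V : ι → ι → ℂ | Matrix.of V ∈ unitaryGroup ι ℂ} := by
  have : {V : ι → ι → ℂ | Matrix.of V ∈ unitaryGroup ι ℂ} =
      ⋂ i, ⋂ j, {V : ι → ι → ℂ | ∑ k, V i k * star (V j k) = (1 : Matrix ι ι ℂ) i j} := by
    ext V
    simp only [Set.mem_ofPred_eq, mem_unitaryGroup_iff, Set.mem_iInter]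
    rw [← Matrix.ext_iff]
    rfl
  rw [this]
  exact isClosed_iInter fun i => isClosed_iInter fun j =>
    isClosed_eq (by fun_prop) continuous_const

theorem exists_tendsto_unitary (V : ℕ → Matrix ι ι ℂ) (hV : ∀ n, V n ∈ unitaryGroup ι ℂ) :
    ∃ W ∈ unitaryGroup ι ℂ, ∃ φ : ℕ → ℕ, StrictMono φ ∧
      ∀ i j, Tendsto (fun n => V (φ n) i j) atTop (𝓝 (W i j)) := by
  have hc : IsCompact {V : ι → ι → ℂ | Matrix.of V ∈ unitaryGroup ι ℂ} := by
    refine IsCompact.of_isClosed_subset (isCompact_univ_pi fun _ : ι => isCompact_univ_pi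
      fun _ : ι => isCompact_closedBall (0 : ℂ) 1) isClosed_unitaryGroup ?_
    intro V hV i _ j _
    simpa using entry_norm_bound_of_unitary hV i j
  obtain ⟨W, hW, φ, hφ, hlim⟩ := hc.tendsto_subseq (X := ι → ι → ℂ) (x := V) hV
  refine ⟨W, hW, φ, hφ, fun i j => ?_⟩
  exact (tendsto_pi_nhds.1 ((tendsto_pi_nhds.1 hlim) i)) j

/-- Pigeonhole on the finite label together with compactness of the unitary group. The label will be
the quadruple that violates nondegeneracy and `V` an eigenbasis; this replaces eigenvalue
perturbation theory in both limit arguments below. -/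
theorem exists_limit_frame {τ : Type*} [Finite τ] {Q : ℕ → Matrix ι ι ℂ → τ → Prop}
    (h : ∀ n, ∃ V ∈ unitaryGroup ι ℂ, ∃ q, Q n V q) :
    ∃ q, ∃ φ : ℕ → ℕ, StrictMono φ ∧ ∃ V : ℕ → Matrix ι ι ℂ, ∃ W ∈ unitaryGroup ι ℂ,
      (∀ n, Q (φ n) (V n) q) ∧ ∀ i j, Tendsto (fun n => V n i j) atTop (𝓝 (W i j)) := by
  choose V hV q hq using h
  obtain ⟨q₀, hq₀⟩ : ∃ q₀, ∃ᶠ n in atTop, q n = q₀ := by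
    by_contra! hc
    have := eventually_all.2 hc
    obtain ⟨n, hn⟩ := this.exists
    exact hn (q n) rfl
  obtain ⟨φ, hφ, hφq⟩ := extraction_of_frequently_atTop hq₀
  obtain ⟨W, hW, ψ, hψ, hlim⟩ := exists_tendsto_unitary (fun n => V (φ n)) (fun n => hV _)
  refine ⟨q₀, φ ∘ ψ, hφ.comp hψ, fun n => V (φ (ψ n)), W, hW, fun n => ?_, hlim⟩
  have := hq (φ (ψ n))
  rwa [hφq] at this

theorem exists_ne_zero_of_mem_unitaryGroup {W : Matrix ι ι ℂ} (hW : W ∈ unitaryGroup ι ℂ)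
    (a : ι) : ∃ x, W x a ≠ 0 := by
  by_contra! h
  have h1 := congrFun (congrFun (mem_unitaryGroup_iff'.1 hW) a) a
  simp [mul_apply, h] at h1

end Compactness

/-! ### The strong-coupling limit -/

section Pinching

variable {ι Γ : Type*} [Fintype ι] [DecidableEq ι] [Fintype Γ] [DecidableEq Γ]

/-- A convergent sequence can cancel `φ n * s` with `φ n → ∞` only if `s = 0`. A coincidence of pair
sums thus splits into its leading and its order-one part. -/
theorem tendsto_eq_zero_of_mul_nat {u : ℕ → ℂ} {l s : ℂ} {φ : ℕ → ℕ} (hφ : StrictMono φ)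
    (hu : Tendsto u atTop (𝓝 l)) (h : ∀ᶠ n in atTop, u n + (φ n : ℂ) * s = 0) :
    s = 0 ∧ l = 0 := by
  have hinv : Tendsto (fun n => ((φ n : ℂ))⁻¹) atTop (𝓝 0) := by
    have := (tendsto_inv_atTop_nhds_zero_nat (𝕜 := ℂ)).comp hφ.tendsto_atTop
    exact this
  have h0 : Tendsto (fun n => u n * ((φ n : ℂ))⁻¹) atTop (𝓝 (l * 0)) := hu.mul hinv
  have hs : Tendsto (fun n => u n * ((φ n : ℂ))⁻¹) atTop (𝓝 (-s)) := by
    refine tendsto_const_nhds.congr' ?_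
    filter_upwards [h, hφ.tendsto_atTop.eventually_gt_atTop 0] with n hn hpos
    have : (φ n : ℂ) ≠ 0 := by exact_mod_cast hpos.ne'
    field_simp
    linear_combination -hn
  have hs0 : s = 0 := by
    have := tendsto_nhds_unique h0 hs
    simpa using this.symm
  refine ⟨hs0, ?_⟩
  refine tendsto_nhds_unique (hu.congr' ?_) tendsto_const_nhds
  filter_upwards [h] with n hn
  simpa [hs0] using hn

/-- Strong-coupling limit: if the block-diagonal part of `B`, together with a multiple of the
block scalar `k`, has nondegenerate pair sums, then so has `R • k + B` for some `R`. -/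
theorem SumNondegenerate.of_pinching (k : Γ → ℂ) (hk : Function.Injective k)
    (B : Matrix (ι × Γ) (ι × Γ) ℂ) (t : ℂ)
    (h : SumNondegenerate (t • diagonal (fun p : ι × Γ => k p.2) +
      Matrix.of fun p q : ι × Γ => if p.2 = q.2 then B p q else 0)) :
    ∃ R : ℝ, SumNondegenerate ((R : ℂ) • diagonal (fun p : ι × Γ => k p.2) + B) := by
  by_contra! hcon
  have hfail : ∀ n : ℕ, ∃ V ∈ unitaryGroup (ι × Γ) ℂ,
      ∃ q : (ι × Γ) × (ι × Γ) × (ι × Γ) × (ι × Γ), ∃ E : ι × Γ → ℂ,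
      (((n : ℝ) : ℂ) • diagonal (fun p : ι × Γ => k p.2) + B) * V = V * diagonal E ∧
      E q.1 + E q.2.1 = E q.2.2.1 + E q.2.2.2 ∧
      ¬ ((q.1 = q.2.2.1 ∧ q.2.1 = q.2.2.2) ∨ (q.1 = q.2.2.2 ∧ q.2.1 = q.2.2.1)) := by
    intro n
    have := hcon n
    simp only [SumNondegenerate, PairDistinct] at this
    push Not at this
    obtain ⟨V, hV, E, hE, a, b, c, d, habcd, h1⟩ := this
    refine ⟨V, hV, (a, b, c, d), E, hE, habcd, ?_⟩
    dsimp only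
    tauto
  obtain ⟨⟨a, b, c, d⟩, φ, hφ, V, W, hW, hQ, hlim⟩ := exists_limit_frame hfail
  choose E hE hsum hne using hQ
  dsimp only at hsum hne
  have hent : ∀ n y x, (E n x - (φ n : ℂ) * k y.2) * V n y x = ∑ z, B y z * V n z x := by
    intro n y x
    have := congrFun (congrFun (hE n) y) x
    rw [add_mul, Matrix.add_apply, smul_mul, Matrix.smul_apply, diagonal_mul, mul_diagonal,
      mul_apply] at this
    simp only [Complex.ofReal_natCast, smul_eq_mul] at this
    linear_combination -this
  have hBlim : ∀ y x, Tendsto (fun n => ∑ z, B y z * V n z x) atTop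
      (𝓝 (∑ z, B y z * W z x)) := fun y x =>
    tendsto_finsetSum _ fun z _ => (hlim z x).const_mul _
  choose x hx using exists_ne_zero_of_mem_unitaryGroup hW
  -- A nonzero coordinate `x a` of the limit vector `a` selects a block: `E n a` is `φ n` times the
  -- scalar of that block plus a correction converging to `e a`.
  set e : ι × Γ → ℂ := fun a => (∑ z, B (x a) z * W z a) / W (x a) a with he
  have helim : ∀ a, Tendsto (fun n => E n a - (φ n : ℂ) * k (x a).2) atTop (𝓝 (e a)) := by
    intro a
    refine ((hBlim (x a) a).div (hlim (x a) a) (hx a)).congr' ?_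
    filter_upwards [(hlim (x a) a).eventually_ne (hx a)] with n hn
    simp only [Pi.div_apply]
    rw [← hent, mul_div_assoc, div_self hn, mul_one]
  -- Divided by `φ n`, the eigenvalue equation loses `B` in the limit, so the limit vector lives in
  -- a single block.
  have hblock : ∀ y a, k y.2 ≠ k (x a).2 → W y a = 0 := by
    intro y a hy
    have hinv : Tendsto (fun n => ((φ n : ℂ))⁻¹) atTop (𝓝 0) :=
      (tendsto_inv_atTop_nhds_zero_nat (𝕜 := ℂ)).comp hφ.tendsto_atTop
    have h2 : Tendsto (fun n => ((∑ z, B y z * V n z a) -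
        (E n a - (φ n : ℂ) * k (x a).2) * V n y a) * ((φ n : ℂ))⁻¹) atTop
        (𝓝 (((∑ z, B y z * W z a) - e a * W y a) * 0)) :=
      ((hBlim y a).sub ((helim a).mul (hlim y a))).mul hinv
    have h3 : Tendsto (fun n => (k (x a).2 - k y.2) * V n y a) atTop
        (𝓝 (((∑ z, B y z * W z a) - e a * W y a) * 0)) := by
      refine h2.congr' ?_
      filter_upwards [hφ.tendsto_atTop.eventually_gt_atTop 0] with n hpos
      have : (φ n : ℂ) ≠ 0 := by exact_mod_cast hpos.ne'
      rw [← hent]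
      field_simp
      ring
    have h4 := tendsto_nhds_unique h3 ((hlim y a).const_mul _)
    rw [mul_zero] at h4
    exact (mul_eq_zero.1 h4.symm).resolve_left (sub_ne_zero.2 hy.symm)
  have heig : ∀ y a, y.2 = (x a).2 → ∑ z, B y z * W z a = e a * W y a := by
    intro y a hy
    refine tendsto_nhds_unique (hBlim y a) (((helim a).mul (hlim y a)).congr fun n => ?_)
    rw [← hent, hy]
  -- On one block the order-one part of the equation sees only the pinched `B`, and `t • k` is a
  -- constant there; hence `W` diagonalizes the matrix in the hypothesis.
  have hdiag : (t • diagonal (fun p : ι × Γ => k p.2) +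
      Matrix.of fun p q : ι × Γ => if p.2 = q.2 then B p q else 0) * W =
      W * diagonal fun a => t * k (x a).2 + e a := by
    ext y a
    rw [add_mul, Matrix.add_apply, smul_mul, Matrix.smul_apply, diagonal_mul, mul_diagonal,
      mul_apply]
    simp only [of_apply, ite_mul, zero_mul, smul_eq_mul]
    by_cases hy : y.2 = (x a).2
    · have : ∑ z, (if y.2 = z.2 then B y z * W z a else 0) = ∑ z, B y z * W z a := by
        refine Finset.sum_congr rfl fun z _ => ?_
        split_ifs with hz
        · rfl
        · rw [hblock z a (fun hh => hz (hy.trans (hk hh).symm)), mul_zero]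
      rw [this, heig y a hy, hy]
      ring
    · have : ∑ z, (if y.2 = z.2 then B y z * W z a else 0) = 0 := by
        refine Finset.sum_eq_zero fun z _ => ?_
        split_ifs with hz
        · rw [hblock z a (fun hh => hy (hz.trans (hk hh))), mul_zero]
        · rfl
      rw [this, hblock y a (fun hh => hy (hk hh))]
      ring
  have hlimsum := (((helim a).add (helim b)).sub (helim c)).sub (helim d)
  obtain ⟨hks, hes⟩ := tendsto_eq_zero_of_mul_nat
    (s := k (x a).2 + k (x b).2 - k (x c).2 - k (x d).2) hφ hlimsum
    (Eventually.of_forall fun n => by linear_combination hsum n)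
  refine hne 0 (h W hW _ hdiag a b c d ?_)
  linear_combination t * hks + hes

end Pinching

end Floquet

namespace Floquet

open Matrix Topology
open scoped Kronecker

theorem PairDistinct.injective {ι R : Type*} [Add R] {E : ι → R} (h : PairDistinct E) :
    Function.Injective E := by
  intro a b hab
  rcases h a a b b (by rw [hab]) with h | h <;> exact h.1

/-! ### Invariance of nondegeneracy, and the diagonal case -/

section Transfer

variable {ι κ : Type*} [Fintype ι] [DecidableEq ι] [Fintype κ] [DecidableEq κ]

theorem SumNondegenerate.conj {M : Matrix ι ι ℂ} (h : SumNondegenerate M) {Q : Matrix ι ι ℂ}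
    (hQ : Q ∈ unitaryGroup ι ℂ) : SumNondegenerate (star Q * M * Q) := by
  intro V hV E hE
  refine h (Q * V) (mul_mem hQ hV) E ?_
  calc M * (Q * V) = Q * star Q * M * (Q * V) := by rw [mem_unitaryGroup_iff.1 hQ, one_mul]
    _ = Q * (star Q * M * Q * V) := by simp only [mul_assoc]
    _ = Q * V * diagonal E := by rw [hE, mul_assoc]

theorem SumNondegenerate.submatrix {M : Matrix κ κ ℂ} (h : SumNondegenerate M) (e : ι ≃ κ) :
    SumNondegenerate (M.submatrix e e) := by
  intro V hV E hE
  have hV' : V.submatrix e.symm e.symm ∈ unitaryGroup κ ℂ := by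
    rw [mem_unitaryGroup_iff] at hV ⊢
    rw [star_eq_conjTranspose, conjTranspose_submatrix, submatrix_mul_equiv,
      ← star_eq_conjTranspose, hV, submatrix_one_equiv]
  have h1 : M * V.submatrix e.symm e.symm =
      V.submatrix e.symm e.symm * diagonal (E ∘ e.symm) := by
    have := congrArg (fun X => X.submatrix e.symm e.symm) hE
    simp only [← submatrix_mul_equiv _ _ e.symm e.symm e.symm, submatrix_submatrix,
      submatrix_diagonal_equiv] at this
    simpa using this
  intro a b c d habcd
  simpa using h _ hV' _ h1 (e a) (e b) (e c) (e d) (by simpa using habcd)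

/-- An eigenbasis of a diagonal matrix with distinct entries is the standard basis up to order and
phases, so its eigenvalues are the entries relabelled by a permutation `σ`. -/
theorem PairDistinct.sumNondegenerate_diagonal {E : ι → ℂ} (h : PairDistinct E) :
    SumNondegenerate (diagonal E) := by
  intro V hV E' hE'
  have hent : ∀ i j, E i * V i j = V i j * E' j := by
    intro i j
    have := congrFun (congrFun hE' i) j
    rwa [diagonal_mul, mul_diagonal] at this
  choose σ hσ using exists_ne_zero_of_mem_unitaryGroup hV
  have hEσ : ∀ j, E' j = E (σ j) := fun j =>
    mul_left_cancel₀ (hσ j) (by rw [← hent, mul_comm])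
  have hsupp : ∀ i j, i ≠ σ j → V i j = 0 := by
    intro i j hij
    by_contra hne
    exact hij (h.injective ((mul_left_cancel₀ hne (by rw [← hent, mul_comm])).symm.trans (hEσ j)))
  have hinj : Function.Injective σ := by
    intro j j' hjj
    by_contra hne
    have h1 := congrFun (congrFun (mem_unitaryGroup_iff'.1 hV) j) j'
    rw [mul_apply, Finset.sum_eq_single (σ j), one_apply_ne hne] at h1
    · refine mul_ne_zero ?_ ?_ h1
      · simpa using hσ j
      · rw [hjj]; exact hσ j'
    · intro i _ hi
      rw [hsupp i j' (by rwa [← hjj]), mul_zero]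
    · simp
  intro a b c d habcd
  simp only [hEσ] at habcd
  simpa [hinj.eq_iff] using h _ _ _ _ habcd

end Transfer

/-! ### A chain with nondegenerate pair sums -/

/-- Splits off the first qubit. -/
def splitFirst (l : ℕ) : Config (l + 1) ≃ Config l × Fin 2 :=
  (Fin.consEquiv fun _ => Fin 2).symm.trans (Equiv.prodComm _ _)

@[simp]
theorem splitFirst_apply (l : ℕ) (s : Config (l + 1)) : splitFirst l s = (Fin.tail s, s 0) := rfl

theorem siteOp_zero (l : ℕ) (u : Axis) : (siteOp 0 u : Op (l + 1)) =
    ((1 : Op l) ⊗ₖ pauli u).submatrix (splitFirst l) (splitFirst l) := by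
  ext s s'
  have : (∀ k : Fin (l + 1), k ≠ 0 → s k = s' k) ↔ Fin.tail s = Fin.tail s' := by
    simp [Fin.forall_fin_succ, funext_iff, Fin.tail]
  simp [siteOp, this, one_apply]

theorem siteOp_succ (l : ℕ) (i : Fin l) (u : Axis) : (siteOp i.succ u : Op (l + 1)) =
    (siteOp i u ⊗ₖ (1 : Matrix (Fin 2) (Fin 2) ℂ)).submatrix (splitFirst l) (splitFirst l) := by
  ext s s'
  have : (∀ k : Fin (l + 1), k ≠ i.succ → s k = s' k) ↔
      s 0 = s' 0 ∧ ∀ k, k ≠ i → Fin.tail s k = Fin.tail s' k := by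
    simp [Fin.forall_fin_succ, Fin.tail, (Fin.succ_ne_zero i).symm]
  simp only [siteOp, this, submatrix_apply, splitFirst_apply, kronecker_apply, one_apply]
  by_cases h : s 0 = s' 0
  · simp only [h, true_and, if_true, mul_one]
    congr
  · simp [h]

/-- The field along `z` on the first site. -/
def edgeField (l : ℕ) (R : Fin l → ℝ) : Op l :=
  ∑ i : Fin l, (if i.val = 0 then (R i : ℂ) else 0) • siteOp i Axis.z

/-- Ising chain with `h_i^x = R_i`, bonds `R_{i+1}`, and `h_i^z = 2 R_i` except on the first
site. -/
def edgelessChain (l : ℕ) (R : Fin l → ℝ) : Op l :=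
  ∑ i : Fin l, (R i : ℂ) • siteOp i Axis.x +
    ∑ i : Fin l, (if i.val = 0 then 0 else 2 * (R i : ℂ)) • siteOp i Axis.z +
    ∑ b : Fin (l - 1), (R (bondRight b) : ℂ) •
      (siteOp (bondLeft b) Axis.z * siteOp (bondRight b) Axis.z)

theorem edgeField_succ (l : ℕ) (R : Fin (l + 1) → ℝ) :
    edgeField (l + 1) R = (R 0 : ℂ) • siteOp 0 Axis.z := by
  simp [edgeField]

theorem submatrix_finsetSum {α β γ : Type*} (f : α → β) (s : Finset γ) (M : γ → Matrix β β ℂ) :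
    (∑ i ∈ s, M i).submatrix f f = ∑ i ∈ s, (M i).submatrix f f := by
  ext i j
  simp [Matrix.sum_apply]

theorem sum_kronecker {α β γ : Type*} (s : Finset γ) (M : γ → Matrix α α ℂ) (X : Matrix β β ℂ) :
    (∑ i ∈ s, M i) ⊗ₖ X = ∑ i ∈ s, M i ⊗ₖ X := by
  ext i j
  simp [Matrix.sum_apply, Finset.sum_mul]

/-- The bond between the first two sites has the strength `R 1` of the second site, which is also
the coefficient in the edge field of the tail. All terms touching the new first site thus scale with
`R 0` or with that edge field, which makes the induction close. -/
theorem bond_sum_succ (l : ℕ) (R : Fin (l + 1) → ℝ) :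
    ∑ b : Fin (l + 1 - 1), (R (bondRight b) : ℂ) •
      (siteOp (bondLeft b) Axis.z * siteOp (bondRight b) Axis.z) =
    (edgeField l (Fin.tail R) ⊗ₖ pauli Axis.z +
      (∑ b : Fin (l - 1), (Fin.tail R (bondRight b) : ℂ) •
        (siteOp (bondLeft b) Axis.z * siteOp (bondRight b) Axis.z)) ⊗ₖ
        (1 : Matrix (Fin 2) (Fin 2) ℂ)).submatrix (splitFirst l) (splitFirst l) := by
  cases l with
  | zero =>
    simp [edgeField]
  | succ m =>
    rw [submatrix_add, edgeField_succ, sum_kronecker, Pi.add_apply, Pi.add_apply,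
      submatrix_finsetSum]
    change ∑ b : Fin (m + 1), _ = _
    rw [Fin.sum_univ_succ]
    congr 1
    · have h0 : bondLeft (N := m + 1 + 1) (0 : Fin (m + 1)) = 0 := rfl
      have h1 : bondRight (N := m + 1 + 1) (0 : Fin (m + 1)) = Fin.succ 0 := rfl
      rw [h0, h1, siteOp_zero, siteOp_succ, submatrix_mul_equiv, ← mul_kronecker_mul, one_mul,
        mul_one, smul_kronecker]
      rfl
    · refine Finset.sum_congr rfl fun b _ => ?_
      have h0 : bondLeft (N := m + 1 + 1) (b.succ : Fin (m + 1)) =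
          Fin.succ (bondLeft (N := m + 1) b) := rfl
      have h1 : bondRight (N := m + 1 + 1) (b.succ : Fin (m + 1)) =
          Fin.succ (bondRight (N := m + 1) b) := rfl
      rw [h0, h1, siteOp_succ, siteOp_succ, submatrix_mul_equiv, ← mul_kronecker_mul, one_mul,
        smul_kronecker]
      rfl

/-- The second site of the long chain is the edge of the tail, so its field `2 * R 1` has to be
restored; together with the bond, the tail's edge sees `2 + σ_z` of the removed qubit. -/
theorem edgelessChain_succ (l : ℕ) (R : Fin (l + 1) → ℝ) :
    edgelessChain (l + 1) R = ((1 : Op l) ⊗ₖ ((R 0 : ℂ) • pauli Axis.x) +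
      (edgelessChain l (Fin.tail R) + (2 : ℂ) • edgeField l (Fin.tail R)) ⊗ₖ
        (1 : Matrix (Fin 2) (Fin 2) ℂ) +
      edgeField l (Fin.tail R) ⊗ₖ pauli Axis.z).submatrix (splitFirst l) (splitFirst l) := by
  have hz : (∑ i : Fin l, (if i.val = 0 then 0 else 2 * (Fin.tail R i : ℂ)) • siteOp i Axis.z) +
      (2 : ℂ) • edgeField l (Fin.tail R) =
      ∑ i : Fin l, (2 * (Fin.tail R i : ℂ)) • siteOp i Axis.z := by
    rw [edgeField, Finset.smul_sum, ← Finset.sum_add_distrib]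
    refine Finset.sum_congr rfl fun i _ => ?_
    split_ifs
    · rw [zero_smul, zero_add, smul_smul]
    · rw [zero_smul, smul_zero, add_zero]
  rw [edgelessChain, bond_sum_succ, Fin.sum_univ_succ, Fin.sum_univ_succ]
  simp only [Fin.val_zero, if_true, zero_smul, zero_add, Fin.val_succ, Nat.succ_ne_zero, if_false,
    siteOp_zero, siteOp_succ]
  have hsplit : edgelessChain l (Fin.tail R) + (2 : ℂ) • edgeField l (Fin.tail R) =
      ∑ i : Fin l, (Fin.tail R i : ℂ) • siteOp i Axis.x +
      ∑ i : Fin l, (2 * (Fin.tail R i : ℂ)) • siteOp i Axis.z +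
      ∑ b : Fin (l - 1), (Fin.tail R (bondRight b) : ℂ) •
        (siteOp (bondLeft b) Axis.z * siteOp (bondRight b) Axis.z) := by
    rw [← hz, edgelessChain]
    abel
  rw [hsplit]
  simp only [submatrix_add, Pi.add_apply, add_kronecker, sum_kronecker, smul_kronecker,
    kronecker_smul, submatrix_finsetSum, submatrix_smul, Pi.smul_apply, Fin.tail]
  abel

end Floquet

namespace Floquet

open Matrix Topology
open scoped Kronecker

/-- The sign `±1` of a basis state of a qubit. -/
def spinSign : Fin 2 → ℝ := ![1, -1]

/-! ### Separation of sums by spins and scalars -/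

section ScalarLemmas

variable {Λ : Type*}

/-- For two different pairs the difference of the sums is affine in `t` and not identically zero, so
each quadruple rules out at most one `t`. -/
theorem exists_pairDistinct_add_mul [Finite Λ] {e k : Λ → ℝ}
    (h : ∀ a b c d, e a + e b = e c + e d → k a + k b = k c + k d →
      (a = c ∧ b = d) ∨ (a = d ∧ b = c)) :
    ∃ t : ℝ, PairDistinct fun a => e a + t * k a := by
  let bad : Λ × Λ × Λ × Λ → Set ℝ := fun q =>
    {t | e q.1 + t * k q.1 + (e q.2.1 + t * k q.2.1) =
        e q.2.2.1 + t * k q.2.2.1 + (e q.2.2.2 + t * k q.2.2.2) ∧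
      ¬ ((q.1 = q.2.2.1 ∧ q.2.1 = q.2.2.2) ∨ (q.1 = q.2.2.2 ∧ q.2.1 = q.2.2.1))}
  have hfin : (⋃ q, bad q).Finite := by
    refine Set.finite_iUnion fun q => Set.Subsingleton.finite ?_
    rintro t ⟨ht, hq⟩ t' ⟨ht', -⟩
    have h1 : (t - t') * (k q.1 + k q.2.1 - k q.2.2.1 - k q.2.2.2) = 0 := by
      linear_combination ht - ht'
    rcases mul_eq_zero.1 h1 with h2 | h2
    · exact sub_eq_zero.1 h2
    · refine absurd (h q.1 q.2.1 q.2.2.1 q.2.2.2 ?_ ?_) hq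
      · linear_combination ht - t * h2
      · linear_combination h2
  obtain ⟨t, ht⟩ := hfin.exists_notMem
  refine ⟨t, fun a b c d habcd => ?_⟩
  by_contra hne
  exact ht (Set.mem_iUnion.2 ⟨(a, b, c, d), habcd, hne⟩)

/-- The sums of `e` fix the two register labels. Then distinct positive `r` separate the signs,
except that equal labels allow the two spins to be exchanged. -/
theorem spin_pair_distinct {e r : Λ → ℝ} (he : PairDistinct e) (hr : Function.Injective r)
    (hpos : ∀ i, 0 < r i) (a b c d : Fin 2 × Λ) (h : e a.2 + e b.2 = e c.2 + e d.2)
    (h' : spinSign a.1 * r a.2 + spinSign b.1 * r b.2 =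
      spinSign c.1 * r c.2 + spinSign d.1 * r d.2) :
    (a = c ∧ b = d) ∨ (a = d ∧ b = c) := by
  have key : ∀ (s t u v : Fin 2) (i j : Λ), spinSign s * r i + spinSign t * r j =
      spinSign u * r i + spinSign v * r j → (s = u ∧ t = v) ∨ (i = j ∧ s = v ∧ t = u) := by
    intro s t u v i j hh
    have hi := hpos i
    have hj := hpos j
    by_cases hij : i = j
    · subst hij
      fin_cases s <;> fin_cases t <;> fin_cases u <;> fin_cases v <;>
        simp [spinSign] at hh ⊢ <;> linarith
    · have hne : r i ≠ r j := fun hh => hij (hr hh)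
      fin_cases s <;> fin_cases t <;> fin_cases u <;> fin_cases v <;>
        simp [spinSign, hij] at hh ⊢ <;>
        first | linarith | exact hne (by linarith)
  obtain ⟨sa, ia⟩ := a
  obtain ⟨sb, ib⟩ := b
  obtain ⟨sc, ic⟩ := c
  obtain ⟨sd, id⟩ := d
  simp only [Prod.mk.injEq] at *
  rcases he _ _ _ _ h with ⟨rfl, rfl⟩ | ⟨rfl, rfl⟩
  · rcases key _ _ _ _ _ _ h' with hh | ⟨rfl, hh⟩ <;> tauto
  · rcases key sa sb sd sc ia ib (by linarith) with hh | ⟨rfl, hh⟩ <;> tauto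

/-- Rotation data taking `σ_x + ζ σ_z` to `√(1 + ζ²) σ_z`. -/
theorem exists_rotation (ζ : ℝ) : ∃ a b : ℝ, a ^ 2 + b ^ 2 = 1 ∧
    √(1 + ζ ^ 2) * (a ^ 2 - b ^ 2) = ζ ∧ √(1 + ζ ^ 2) * (2 * a * b) = 1 := by
  set r := √(1 + ζ ^ 2) with hr
  have hr2 : r ^ 2 = 1 + ζ ^ 2 := Real.sq_sqrt (by positivity)
  have hrpos : 0 < r := Real.sqrt_pos.2 (by positivity)
  have hle : |ζ| ≤ r := Real.abs_le_sqrt (by linarith)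
  obtain ⟨h1, h2⟩ := abs_le.1 hle
  have ha : 0 ≤ (1 + ζ / r) / 2 := by
    have : -1 ≤ ζ / r := by rw [le_div_iff₀ hrpos]; linarith
    linarith
  have hb : 0 ≤ (1 - ζ / r) / 2 := by
    have : ζ / r ≤ 1 := by rw [div_le_iff₀ hrpos]; linarith
    linarith
  -- Half-angle formulas: these are `cos (θ/2)` and `sin (θ/2)` for `cos θ = ζ / r`, `sin θ = 1 /
  -- r`.
  refine ⟨√((1 + ζ / r) / 2), √((1 - ζ / r) / 2), ?_, ?_, ?_⟩
  · rw [Real.sq_sqrt ha, Real.sq_sqrt hb]; ring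
  · rw [Real.sq_sqrt ha, Real.sq_sqrt hb]; field_simp; ring
  · rw [mul_assoc, ← Real.sqrt_mul ha]
    have : (1 + ζ / r) / 2 * ((1 - ζ / r) / 2) = (1 / (2 * r)) ^ 2 := by
      field_simp
      linear_combination hr2
    rw [this, Real.sqrt_sq (by positivity)]
    field_simp

theorem cos_strictMono {x y : ℝ} (hx : 0 < x) (hy : 0 < y)
    (h : x / √(1 + x ^ 2) = y / √(1 + y ^ 2)) : x = y := by
  have hx1 : 0 < √(1 + x ^ 2) := Real.sqrt_pos.2 (by positivity)
  have hy1 : 0 < √(1 + y ^ 2) := Real.sqrt_pos.2 (by positivity)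
  have hx2 := Real.sq_sqrt (show 0 ≤ 1 + x ^ 2 by positivity)
  have hy2 := Real.sq_sqrt (show 0 ≤ 1 + y ^ 2 by positivity)
  rw [div_eq_div_iff hx1.ne' hy1.ne'] at h
  have h1 : (x * √(1 + y ^ 2)) ^ 2 = (y * √(1 + x ^ 2)) ^ 2 := by rw [h]
  rw [mul_pow, mul_pow, hx2, hy2] at h1
  have : x ^ 2 = y ^ 2 := by linarith
  exact (pow_left_inj₀ hx.le hy.le two_ne_zero).1 this

end ScalarLemmas

/-- Pinching in the register keeps only the diagonal of `Y`, and `t • k` can be read as part of the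
register energies. The result has the form required by the induction hypothesis for the shorter
chain. -/
theorem pinched_chain_eq {l : ℕ} {Γ : Type*} [Fintype Γ] [DecidableEq Γ] (A Z : Op l)
    (Y : Matrix Γ Γ ℂ) (k e y : Γ → ℂ) (t : ℂ) (hY : ∀ γ, Y γ γ = y γ) :
    A ⊗ₖ (1 : Matrix Γ Γ ℂ) + Z ⊗ₖ diagonal (fun γ => 2 + y γ) +
      (1 : Op l) ⊗ₖ diagonal (fun γ => e γ + t * k γ) =
    t • diagonal (fun p : Config l × Γ => k p.2) + Matrix.of fun p q : Config l × Γ =>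
      if p.2 = q.2 then (A ⊗ₖ (1 : Matrix Γ Γ ℂ) + Z ⊗ₖ ((2 : ℂ) • (1 : Matrix Γ Γ ℂ) + Y) +
        (1 : Op l) ⊗ₖ diagonal e) p q else 0 := by
  ext ⟨s, γ⟩ ⟨s', γ'⟩
  by_cases hγ : γ = γ'
  · subst hγ
    by_cases hs : s = s'
    · subst hs
      simp [hY]
      ring
    · simp [hY, hs]
  · simp [hγ]

/-- Moves the first qubit of a chain into the label register. -/
def absorbFirst (l : ℕ) (Λ : Type*) : Config (l + 1) × Λ ≃ Config l × (Fin 2 × Λ) :=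
  (Equiv.prodCongr (splitFirst l) (Equiv.refl _)).trans (Equiv.prodAssoc _ _ _)

@[simp]
theorem absorbFirst_apply (l : ℕ) {Λ : Type*} (p : Config (l + 1) × Λ) :
    absorbFirst l Λ p = (Fin.tail p.1, (p.1 0, p.2)) := rfl

/-! ### Absorbing a qubit into the register -/

section Rotation

variable {Λ : Type*} [DecidableEq Λ]

/-- The block rotation `a σ_z + b σ_x`. -/
def blockRotation (a b : Λ → ℝ) : Matrix (Fin 2 × Λ) (Fin 2 × Λ) ℂ :=
  blockDiagonal fun i => (a i : ℂ) • pauli Axis.z + (b i : ℂ) • pauli Axis.x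

theorem star_blockRotation (a b : Λ → ℝ) : star (blockRotation a b) = blockRotation a b := by
  rw [blockRotation, star_eq_conjTranspose, blockDiagonal_conjTranspose]
  congr 1
  funext i
  ext u v
  fin_cases u <;> fin_cases v <;> simp [pauli]

theorem rotation_mul_rotation {a b : ℝ} (h : a ^ 2 + b ^ 2 = 1) :
    ((a : ℂ) • pauli Axis.z + (b : ℂ) • pauli Axis.x) *
      ((a : ℂ) • pauli Axis.z + (b : ℂ) • pauli Axis.x) = 1 := by
  have h' : (a : ℂ) ^ 2 + (b : ℂ) ^ 2 = 1 := by exact_mod_cast h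
  ext u v
  fin_cases u <;> fin_cases v <;> simp [pauli, mul_apply] <;>
    first | linear_combination h' | ring

theorem rotation_conj_z (a b : ℝ) :
    ((a : ℂ) • pauli Axis.z + (b : ℂ) • pauli Axis.x) * pauli Axis.z *
      ((a : ℂ) • pauli Axis.z + (b : ℂ) • pauli Axis.x) =
    ((a ^ 2 - b ^ 2 : ℝ) : ℂ) • pauli Axis.z + ((2 * a * b : ℝ) : ℂ) • pauli Axis.x := by
  ext u v
  fin_cases u <;> fin_cases v <;> simp [pauli, mul_apply] <;> ring

theorem blockRotation_mul_self [Fintype Λ] {a b : Λ → ℝ} (h : ∀ i, a i ^ 2 + b i ^ 2 = 1) :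
    blockRotation a b * blockRotation a b = 1 := by
  rw [blockRotation, ← blockDiagonal_mul]
  simp_rw [rotation_mul_rotation (h _)]
  exact blockDiagonal_one

theorem blockRotation_conj_diagonal [Fintype Λ] (a b e : Λ → ℝ) (h : ∀ i, a i ^ 2 + b i ^ 2 = 1) :
    blockRotation a b * diagonal (fun γ : Fin 2 × Λ => (e γ.2 : ℂ)) * blockRotation a b =
      diagonal (fun γ : Fin 2 × Λ => (e γ.2 : ℂ)) := by
  have : diagonal (fun γ : Fin 2 × Λ => (e γ.2 : ℂ)) =
      blockDiagonal fun i => (e i : ℂ) • (1 : Matrix (Fin 2) (Fin 2) ℂ) := by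
    ext ⟨u, i⟩ ⟨v, j⟩
    by_cases hij : i = j <;> by_cases huv : u = v <;>
      simp [blockDiagonal_apply, hij, huv]
  rw [this, blockRotation, ← blockDiagonal_mul, ← blockDiagonal_mul]
  simp only [Matrix.mul_smul, Matrix.smul_mul, mul_one, rotation_mul_rotation (h _)]

/-- The transverse field and the register-dependent edge field of the first qubit combine to `R *
(σ_x + ζ_i σ_z)`. This is the only term containing `R`, hence the one that dominates for large `R`.
-/
theorem chain_absorbFirst (l : ℕ) (R : ℝ) (R' : Fin l → ℝ) (ζ e : Λ → ℝ) :
    edgelessChain (l + 1) (Fin.cons R R') ⊗ₖ (1 : Matrix Λ Λ ℂ) +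
      edgeField (l + 1) (Fin.cons R R') ⊗ₖ diagonal (fun i => (ζ i : ℂ)) +
      (1 : Op (l + 1)) ⊗ₖ diagonal (fun i => (e i : ℂ)) =
    ((R : ℂ) • (1 : Op l) ⊗ₖ blockDiagonal (fun i => pauli Axis.x + (ζ i : ℂ) • pauli Axis.z) +
      (edgelessChain l R' ⊗ₖ (1 : Matrix (Fin 2 × Λ) (Fin 2 × Λ) ℂ) +
        edgeField l R' ⊗ₖ ((2 : ℂ) • (1 : Matrix (Fin 2 × Λ) (Fin 2 × Λ) ℂ) +
          blockDiagonal fun _ => pauli Axis.z) +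
        (1 : Op l) ⊗ₖ diagonal (fun γ : Fin 2 × Λ => (e γ.2 : ℂ)))).submatrix
      (absorbFirst l Λ) (absorbFirst l Λ) := by
  have hone : ∀ s s' : Config (l + 1), (1 : Op (l + 1)) s s' =
      (1 : Op l) (Fin.tail s) (Fin.tail s') * (1 : Matrix (Fin 2) (Fin 2) ℂ) (s 0) (s' 0) := by
    intro s s'
    have : s = s' ↔ Fin.tail s = Fin.tail s' ∧ s 0 = s' 0 := by
      simp [funext_iff, Fin.forall_fin_succ, Fin.tail, and_comm]
    simp only [one_apply, this]
    by_cases h1 : Fin.tail s = Fin.tail s' <;> by_cases h2 : s 0 = s' 0 <;> simp [h1, h2]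
  rw [edgelessChain_succ, edgeField_succ, siteOp_zero]
  simp only [Fin.tail_cons, Fin.cons_zero]
  ext ⟨s, i⟩ ⟨s', j⟩
  by_cases hij : i = j
  · subst hij
    simp [hone, blockDiagonal_apply, diagonal_apply, one_apply]
    by_cases h0 : s 0 = s' 0 <;> by_cases h1 : Fin.tail s = Fin.tail s' <;> simp [h0, h1] <;> ring
  · simp [hij, blockDiagonal_apply, one_apply]

/-- In register sector `i` the rotation makes the dominant term diagonal, with entries `±√(1 +
ζ_i²)`, as pinching needs. The coupling `σ_z` to the rest becomes `cos θ_i σ_z + sin θ_i σ_x`, of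
which pinching keeps `± cos θ_i`. -/
theorem chain_rotate (l : ℕ) (R : ℝ) (A Z : Op l) (ζ e a b : Λ → ℝ) [Fintype Λ]
    (hab : ∀ i, a i ^ 2 + b i ^ 2 = 1) (hc : ∀ i, √(1 + ζ i ^ 2) * (a i ^ 2 - b i ^ 2) = ζ i)
    (hs : ∀ i, √(1 + ζ i ^ 2) * (2 * a i * b i) = 1) :
    star ((1 : Op l) ⊗ₖ blockRotation a b) *
      ((R : ℂ) • diagonal (fun p : Config l × (Fin 2 × Λ) =>
          ((spinSign p.2.1 * √(1 + ζ p.2.2 ^ 2) : ℝ) : ℂ)) +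
        (A ⊗ₖ (1 : Matrix (Fin 2 × Λ) (Fin 2 × Λ) ℂ) +
          Z ⊗ₖ ((2 : ℂ) • (1 : Matrix (Fin 2 × Λ) (Fin 2 × Λ) ℂ) +
            blockDiagonal fun i => ((a i ^ 2 - b i ^ 2 : ℝ) : ℂ) • pauli Axis.z +
              ((2 * a i * b i : ℝ) : ℂ) • pauli Axis.x) +
          (1 : Op l) ⊗ₖ diagonal (fun γ : Fin 2 × Λ => (e γ.2 : ℂ)))) *
      ((1 : Op l) ⊗ₖ blockRotation a b) =
    (R : ℂ) • (1 : Op l) ⊗ₖ blockDiagonal (fun i => pauli Axis.x + (ζ i : ℂ) • pauli Axis.z) +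
      (A ⊗ₖ (1 : Matrix (Fin 2 × Λ) (Fin 2 × Λ) ℂ) +
        Z ⊗ₖ ((2 : ℂ) • (1 : Matrix (Fin 2 × Λ) (Fin 2 × Λ) ℂ) +
          blockDiagonal fun _ => pauli Axis.z) +
        (1 : Op l) ⊗ₖ diagonal (fun γ : Fin 2 × Λ => (e γ.2 : ℂ))) := by
  have hq := blockRotation_mul_self hab
  have hstar : star ((1 : Op l) ⊗ₖ blockRotation a b) = (1 : Op l) ⊗ₖ blockRotation a b := by
    rw [star_eq_conjTranspose, conjTranspose_kronecker, conjTranspose_one,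
      ← star_eq_conjTranspose, star_blockRotation]
  have hK : diagonal (fun p : Config l × (Fin 2 × Λ) =>
      ((spinSign p.2.1 * √(1 + ζ p.2.2 ^ 2) : ℝ) : ℂ)) =
      (1 : Op l) ⊗ₖ blockDiagonal fun i => ((√(1 + ζ i ^ 2) : ℝ) : ℂ) • pauli Axis.z := by
    ext ⟨s, u, i⟩ ⟨s', v, j⟩
    by_cases hs : s = s' <;> by_cases hij : i = j <;> fin_cases u <;> fin_cases v <;>
      simp [blockDiagonal_apply, hs, hij, pauli, spinSign]
  have hconj : ∀ (X : Op l) (Y : Matrix (Fin 2 × Λ) (Fin 2 × Λ) ℂ),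
      (1 : Op l) ⊗ₖ blockRotation a b * X ⊗ₖ Y * (1 : Op l) ⊗ₖ blockRotation a b =
        X ⊗ₖ (blockRotation a b * Y * blockRotation a b) := by
    intro X Y
    rw [← mul_kronecker_mul, ← mul_kronecker_mul, one_mul, mul_one]
  have hrot : ∀ i, ((a i : ℂ) • pauli Axis.z + (b i : ℂ) • pauli Axis.x) *
      (((√(1 + ζ i ^ 2) : ℝ) : ℂ) • pauli Axis.z) *
      ((a i : ℂ) • pauli Axis.z + (b i : ℂ) • pauli Axis.x) =
      pauli Axis.x + (ζ i : ℂ) • pauli Axis.z := by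
    intro i
    rw [Matrix.mul_smul, Matrix.smul_mul, rotation_conj_z, smul_add, smul_smul, smul_smul,
      ← Complex.ofReal_mul, ← Complex.ofReal_mul, hc, hs, Complex.ofReal_one, one_smul, add_comm]
  have hback : ∀ i, ((a i : ℂ) • pauli Axis.z + (b i : ℂ) • pauli Axis.x) *
      (((a i ^ 2 - b i ^ 2 : ℝ) : ℂ) • pauli Axis.z + ((2 * a i * b i : ℝ) : ℂ) • pauli Axis.x) *
      ((a i : ℂ) • pauli Axis.z + (b i : ℂ) • pauli Axis.x) = pauli Axis.z := by
    intro i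
    rw [← rotation_conj_z]
    simp only [← mul_assoc]
    rw [rotation_mul_rotation (hab i), one_mul, mul_assoc, rotation_mul_rotation (hab i), mul_one]
  rw [hstar, hK]
  simp only [mul_add, add_mul, Matrix.mul_smul, Matrix.smul_mul, hconj]
  rw [mul_one, hq, blockRotation_conj_diagonal _ _ _ hab]
  congr 1
  · congr 2
    rw [blockRotation, ← blockDiagonal_mul, ← blockDiagonal_mul]
    simp only [hrot]
  · congr 4
    rw [blockRotation, ← blockDiagonal_mul, ← blockDiagonal_mul]
    simp only [hback]

end Rotation

/-- Induction on the length of the chain, with a register that records the states of the qubits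
already absorbed: `e` holds their energies and `ζ` the field they exert on the next site. Absorbing
a qubit replaces `ζ` by `2 ± ζ / √(1 + ζ²)` and `e` by `e ± t √(1 + ζ²)`. The first is again
positive and injective, the second again has distinct pair sums for a suitable `t`. -/
theorem exists_chain_register_sumNondegenerate (l : ℕ) :
    ∀ {Λ : Type} [Fintype Λ] [DecidableEq Λ] (ζ e : Λ → ℝ), Function.Injective ζ →
      (∀ i, 0 < ζ i) → PairDistinct e → ∃ R : Fin l → ℝ,
        SumNondegenerate (edgelessChain l R ⊗ₖ (1 : Matrix Λ Λ ℂ) +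
          edgeField l R ⊗ₖ diagonal (fun i => (ζ i : ℂ)) +
          (1 : Op l) ⊗ₖ diagonal (fun i => (e i : ℂ))) := by
  induction l with
  | zero =>
    intro Λ _ _ ζ e hζ hpos he
    refine ⟨Fin.elim0, ?_⟩
    have : edgelessChain 0 Fin.elim0 ⊗ₖ (1 : Matrix Λ Λ ℂ) +
          edgeField 0 Fin.elim0 ⊗ₖ diagonal (fun i => (ζ i : ℂ)) +
          (1 : Op 0) ⊗ₖ diagonal (fun i => (e i : ℂ)) =
        diagonal fun p : Config 0 × Λ => (e p.2 : ℂ) := by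
      ext ⟨s, i⟩ ⟨s', j⟩
      by_cases hij : i = j <;>
        simp [edgelessChain, edgeField, hij, Subsingleton.elim s s']
    rw [this]
    refine PairDistinct.sumNondegenerate_diagonal fun a b c d habcd => ?_
    have := he a.2 b.2 c.2 d.2 (by exact_mod_cast habcd)
    simpa [Prod.ext_iff, Subsingleton.elim a.1 c.1, Subsingleton.elim b.1 c.1,
      Subsingleton.elim d.1 c.1] using this
  | succ l ih =>
    intro Λ _ _ ζ e hζ hpos he
    choose a b hab hc hs using fun i => exists_rotation (ζ i)
    have hrpos : ∀ i, 0 < √(1 + ζ i ^ 2) := fun i => Real.sqrt_pos.2 (by positivity)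
    have hrinj : Function.Injective fun i => √(1 + ζ i ^ 2) := by
      intro i j hij
      have h1 := (Real.sqrt_inj (show 0 ≤ 1 + ζ i ^ 2 by positivity)
        (show 0 ≤ 1 + ζ j ^ 2 by positivity)).1 hij
      exact hζ ((pow_left_inj₀ (hpos i).le (hpos j).le two_ne_zero).1 (by linarith))
    have hcdiv : ∀ i, a i ^ 2 - b i ^ 2 = ζ i / √(1 + ζ i ^ 2) := fun i => by
      rw [eq_div_iff (hrpos i).ne', mul_comm, hc]
    have hcpos : ∀ i, 0 < a i ^ 2 - b i ^ 2 := fun i => by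
      rw [hcdiv]; exact div_pos (hpos i) (hrpos i)
    -- The offset 2 from the longitudinal field exceeds `cos θ`, so both `2 + cos θ` and `2 - cos θ`
    -- are positive.
    have hclt : ∀ i, a i ^ 2 - b i ^ 2 < 2 := fun i => by
      have := hab i
      nlinarith [sq_nonneg (a i), sq_nonneg (b i)]
    have hcinj : Function.Injective fun i => a i ^ 2 - b i ^ 2 := by
      intro i j hij
      simp only [hcdiv] at hij
      exact hζ (cos_strictMono (hpos i) (hpos j) hij)
    have hsigned : ∀ f : Λ → ℝ, (∀ i, 0 < f i) → Function.Injective f →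
        Function.Injective fun γ : Fin 2 × Λ => spinSign γ.1 * f γ.2 := by
      rintro f hf hfi ⟨u, i⟩ ⟨v, j⟩ huv
      have hi := hf i
      have hj := hf j
      fin_cases u <;> fin_cases v <;> simp [spinSign] at huv ⊢
      · exact hfi huv
      · linarith
      · linarith
      · exact hfi huv
    obtain ⟨t, ht⟩ := exists_pairDistinct_add_mul
      (e := fun γ : Fin 2 × Λ => e γ.2) (k := fun γ => spinSign γ.1 * √(1 + ζ γ.2 ^ 2))
      (spin_pair_distinct he hrinj hrpos)
    obtain ⟨R', hR'⟩ := ih (Λ := Fin 2 × Λ)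
      (fun γ => 2 + spinSign γ.1 * (a γ.2 ^ 2 - b γ.2 ^ 2)) _
      (fun γ γ' h => hsigned _ hcpos hcinj (add_left_cancel h))
      (by
        rintro ⟨u, i⟩
        have h1 := hcpos i
        have h2 := hclt i
        fin_cases u <;> simp [spinSign] <;> linarith) ht
    have hsplit : SumNondegenerate (edgelessChain l R' ⊗ₖ
        (1 : Matrix (Fin 2 × Λ) (Fin 2 × Λ) ℂ) +
        edgeField l R' ⊗ₖ diagonal (fun γ : Fin 2 × Λ =>
          2 + ((spinSign γ.1 * (a γ.2 ^ 2 - b γ.2 ^ 2) : ℝ) : ℂ)) +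
        (1 : Op l) ⊗ₖ diagonal (fun γ : Fin 2 × Λ =>
          (e γ.2 : ℂ) + (t : ℂ) * ((spinSign γ.1 * √(1 + ζ γ.2 ^ 2) : ℝ) : ℂ))) := by
      simpa only [Complex.ofReal_add, Complex.ofReal_mul, Complex.ofReal_ofNat] using hR'
    rw [pinched_chain_eq _ _
      (blockDiagonal fun i => ((a i ^ 2 - b i ^ 2 : ℝ) : ℂ) • pauli Axis.z +
              ((2 * a i * b i : ℝ) : ℂ) • pauli Axis.x) _ _ _ _ (by
        rintro ⟨u, i⟩
        fin_cases u <;> simp [pauli, spinSign])] at hsplit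
    -- The auxiliary `t` disappears here: only the field strength `R` of the absorbed qubit remains,
    -- chosen after the couplings `R'` of the shorter chain.
    obtain ⟨R, hR⟩ := SumNondegenerate.of_pinching _ (fun γ γ' h =>
      hsigned _ hrpos hrinj (Complex.ofReal_injective h)) _ _ hsplit
    refine ⟨Fin.cons R R', ?_⟩
    rw [chain_absorbFirst]
    refine SumNondegenerate.submatrix ?_ _
    rw [← chain_rotate l R _ _ ζ e a b hab hc hs]
    refine SumNondegenerate.conj ?_ ?_
    · exact hR
    · rw [mem_unitaryGroup_iff, star_eq_conjTranspose, conjTranspose_kronecker, conjTranspose_one,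
        ← star_eq_conjTranspose, star_blockRotation, ← mul_kronecker_mul, one_mul,
        blockRotation_mul_self hab, one_kronecker_one]

/-- The Ising chain with `h_l^x = R_l`, `h_l^z = 2 R_l` and bonds `R_{l+1}`. -/
def hierarchicalChain (N : ℕ) (R : Fin N → ℝ) : Op N :=
  ∑ l : Fin N, (R l : ℂ) • siteOp l Axis.x + ∑ l : Fin N, ((2 * R l : ℝ) : ℂ) • siteOp l Axis.z +
    ∑ l : Fin (N - 1), (R (bondRight l) : ℂ) •
      (siteOp (bondLeft l) Axis.z * siteOp (bondRight l) Axis.z)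

theorem exists_hierarchicalChain_sumNondegenerate (N : ℕ) :
    ∃ R : Fin N → ℝ, SumNondegenerate (hierarchicalChain N R) := by
  -- A one-point register with `ζ = 2` restores the missing field `2 * R` on the first site.
  obtain ⟨R, hR⟩ := exists_chain_register_sumNondegenerate N (Λ := Unit) (fun _ => 2) (fun _ => 0)
    (fun _ _ _ => rfl) (fun _ => two_pos) (fun _ _ _ _ _ => Or.inl ⟨rfl, rfl⟩)
  refine ⟨R, ?_⟩
  have hz : edgelessChain N R + (2 : ℂ) • edgeField N R = hierarchicalChain N R := by
    rw [edgelessChain, hierarchicalChain, edgeField, Finset.smul_sum, add_right_comm,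
      add_assoc (Finset.sum _ _) (Finset.sum _ _) (Finset.sum _ _), ← Finset.sum_add_distrib]
    congr 2
    refine Finset.sum_congr rfl fun i _ => ?_
    rw [smul_smul, ← add_smul]
    congr 1
    split_ifs <;> simp
  have := hR.submatrix (Equiv.prodPUnit (Config N)).symm
  convert this using 1
  rw [← hz]
  ext s s'
  simp [mul_comm]

end Floquet

namespace Floquet

open Matrix Topology

/-! ### From pair sums of the generator to gaps of the unitary -/

section ShortTime

variable {ι : Type*} [Fintype ι] [DecidableEq ι]

/-- If the generator of a differentiable family of unitaries has nondegenerate pair sums, some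
member of the family has nondegenerate quasi-energy gaps. -/
theorem exists_gapNondegenerate_of_hasDerivAt {U : ℝ → Matrix ι ι ℂ} {M : Matrix ι ι ℂ}
    (h0 : U 0 = 1) (hU : ∀ i j, HasDerivAt (fun s => U s i j) (-Complex.I * M i j) 0)
    (hM : SumNondegenerate M) : ∃ s, GapNondegenerate (U s) := by
  by_contra! hcon
  set s : ℕ → ℝ := fun n => 1 / ((n : ℝ) + 1) with hs
  have hspos : ∀ n, s n ≠ 0 := fun n => by positivity
  have hs0 : Tendsto s atTop (𝓝 0) := tendsto_one_div_add_atTop_nhds_zero_nat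
  have hfail : ∀ n : ℕ, ∃ V ∈ unitaryGroup ι ℂ, ∃ q : ι × ι × ι × ι, ∃ z : ι → ℂ,
      U (s n) * V = V * diagonal z ∧ z q.1 * z q.2.1 = z q.2.2.1 * z q.2.2.2 ∧
      ¬ ((q.1 = q.2.2.1 ∧ q.2.1 = q.2.2.2) ∨ (q.1 = q.2.2.2 ∧ q.2.1 = q.2.2.1)) := by
    intro n
    have := hcon (s n)
    simp only [GapNondegenerate] at this
    push Not at this
    obtain ⟨V, hV, E, hE, a, b, c, d, habcd, h1⟩ := this
    refine ⟨V, hV, (a, b, c, d), E, hE, habcd, ?_⟩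
    dsimp only
    tauto
  obtain ⟨⟨a, b, c, d⟩, φ, hφ, V, W, hW, hQ, hlim⟩ := exists_limit_frame hfail
  choose z hz hprod hne using hQ
  dsimp only at hprod hne
  have hsφ : Tendsto (fun n => s (φ n)) atTop (𝓝 0) := hs0.comp hφ.tendsto_atTop
  set D : ℕ → Matrix ι ι ℂ := fun n => Matrix.of fun i j =>
    ((s (φ n) : ℂ))⁻¹ * (U (s (φ n)) i j - (1 : Matrix ι ι ℂ) i j) with hD
  -- With `z = 1 + s * m`, equality of products reads `m a + m b + s * m a * m b = m c + m d + s * m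
  -- c * m d`, and the `m` converge to eigenvalues of `-i M`. In the limit this is a coincidence of
  -- pair sums.
  set m : ℕ → ι → ℂ := fun n a => ((s (φ n) : ℂ))⁻¹ * (z n a - 1) with hm
  have hDlim : ∀ i j, Tendsto (fun n => D n i j) atTop (𝓝 (-Complex.I * M i j)) := by
    intro i j
    have h1 := (hasDerivAt_iff_tendsto_slope_zero.1 (hU i j)).comp
      (tendsto_nhdsWithin_iff.2 ⟨hsφ, Eventually.of_forall fun n => hspos (φ n)⟩)
    refine h1.congr fun n => ?_
    simp [hD, h0]
  have hent : ∀ n y x, m n x * V n y x = ∑ w, D n y w * V n w x := by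
    intro n y x
    have h1 := congrFun (congrFun (hz n) y) x
    have h2 : ∑ w, (1 : Matrix ι ι ℂ) y w * V n w x = V n y x := by
      rw [← mul_apply, one_mul]
    rw [mul_diagonal, mul_apply] at h1
    simp only [hD, hm, of_apply, mul_assoc, sub_mul, ← Finset.mul_sum, Finset.sum_sub_distrib]
    rw [h1, h2]
    ring
  have hDVlim : ∀ y x, Tendsto (fun n => ∑ w, D n y w * V n w x) atTop
      (𝓝 (∑ w, -Complex.I * M y w * W w x)) := fun y x =>
    tendsto_finsetSum _ fun w _ => (hDlim y w).mul (hlim w x)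
  choose x hx using exists_ne_zero_of_mem_unitaryGroup hW
  set μ : ι → ℂ := fun a => (∑ w, -Complex.I * M (x a) w * W w a) / W (x a) a with hμ
  have hmlim : ∀ a, Tendsto (fun n => m n a) atTop (𝓝 (μ a)) := by
    intro a
    refine ((hDVlim (x a) a).div (hlim (x a) a) (hx a)).congr' ?_
    filter_upwards [(hlim (x a) a).eventually_ne (hx a)] with n hn
    simp only [Pi.div_apply]
    rw [← hent, mul_div_assoc, div_self hn, mul_one]
  have hdiag : M * W = W * diagonal fun a => Complex.I * μ a := by
    ext y a
    have h1 := tendsto_nhds_unique (hDVlim y a)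
      (((hmlim a).mul (hlim y a)).congr fun n => hent n y a)
    simp only [mul_assoc, ← Finset.mul_sum] at h1
    rw [mul_apply, mul_diagonal]
    linear_combination Complex.I * h1 + (∑ w, M y w * W w a) * Complex.I_mul_I
  have hsC : Tendsto (fun n => (s (φ n) : ℂ)) atTop (𝓝 0) := by
    have := (Complex.continuous_ofReal.tendsto 0).comp hsφ
    simpa [Function.comp_def] using this
  have hl := ((hmlim a).add (hmlim b)).add (hsC.mul ((hmlim a).mul (hmlim b)))
  have hr := ((hmlim c).add (hmlim d)).add (hsC.mul ((hmlim c).mul (hmlim d)))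
  have hsum : μ a + μ b = μ c + μ d := by
    have := tendsto_nhds_unique hl (hr.congr fun n => ?_)
    · simpa using this
    · have hsn : (s (φ n) : ℂ) ≠ 0 := by exact_mod_cast hspos (φ n)
      simp only [hm]
      field_simp
      linear_combination -hprod n
  exact hne 0 (hM W hW _ hdiag a b c d (by linear_combination Complex.I * hsum))

end ShortTime

/-! ### Orthonormal eigenbases of unitary matrices -/

section UnitaryDiagonalization

variable {ι : Type*} [Fintype ι] [DecidableEq ι]

/-- A unitary matrix is normal: its Hermitian parts `X` and `Y` commute and are diagonalized
jointly, and `U = (X + iY) / 2`. -/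
theorem exists_unitary_diagonalization {U : Matrix ι ι ℂ} (hU : U ∈ unitaryGroup ι ℂ) :
    ∃ V ∈ unitaryGroup ι ℂ, ∃ z : ι → ℂ, U * V = V * diagonal z := by
  have hU1 := mem_unitaryGroup_iff.1 hU
  have hU2 := mem_unitaryGroup_iff'.1 hU
  set X : Matrix ι ι ℂ := U + star U with hX
  set Y : Matrix ι ι ℂ := Complex.I • (star U - U) with hY
  have hXh : X.IsHermitian := by
    rw [Matrix.IsHermitian, ← star_eq_conjTranspose, hX, star_add, star_star, add_comm]
  have hYh : Y.IsHermitian := by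
    rw [Matrix.IsHermitian, ← star_eq_conjTranspose, hY, star_smul, star_sub, star_star,
      Complex.star_def, Complex.conj_I, neg_smul, ← smul_neg, neg_sub]
  have hcomm : Commute X Y := by
    refine Commute.smul_right ?_ _
    rw [Commute, SemiconjBy, hX]
    simp only [add_mul, mul_add, mul_sub, sub_mul, hU1, hU2]
    abel
  have hTX := isSymmetric_toEuclideanLin_iff.2 hXh
  have hTY := isSymmetric_toEuclideanLin_iff.2 hYh
  have hTcomm : Commute (toEuclideanLin X) (toEuclideanLin Y) := by
    rw [Commute, SemiconjBy]
    ext v i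
    have h1 := congrFun (congrArg (fun A : Matrix ι ι ℂ => A *ᵥ (v : ι → ℂ)) hcomm.eq) i
    simpa [← mulVec_mulVec] using h1
  have hint := LinearMap.IsSymmetric.directSum_isInternal_of_commute hTX hTY hTcomm
  have horth := LinearMap.IsSymmetric.orthogonalFamily_eigenspace_inf_eigenspace hTX hTY
  -- The joint eigenspaces are indexed by all of `ℂ × ℂ`; a basis subordinate to them needs a finite
  -- family, so the trivial ones are dropped.
  have hint' := DirectSum.isInternal_ne_bot_iff.2 hint
  have hfin : Finite {i : ℂ × ℂ // Module.End.eigenspace (toEuclideanLin X) i.2 ⊓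
      Module.End.eigenspace (toEuclideanLin Y) i.1 ≠ ⊥} :=
    WellFoundedGT.finite_ne_bot_of_iSupIndep hint.submodule_iSupIndep
  have := Fintype.ofFinite {i : ℂ × ℂ // Module.End.eigenspace (toEuclideanLin X) i.2 ⊓
      Module.End.eigenspace (toEuclideanLin Y) i.1 ≠ ⊥}
  have horth' := horth.comp (Subtype.val_injective (p := fun i : ℂ × ℂ =>
    Module.End.eigenspace (toEuclideanLin X) i.2 ⊓
      Module.End.eigenspace (toEuclideanLin Y) i.1 ≠ ⊥))
  have hcard : Module.finrank ℂ (EuclideanSpace ℂ ι) = Fintype.card ι := finrank_euclideanSpace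
  let b := hint'.subordinateOrthonormalBasis hcard horth'
  let idx := fun a => hint'.subordinateOrthonormalBasisIndex hcard a horth'
  have hb : ∀ a, b a ∈ Module.End.eigenspace (toEuclideanLin X) (idx a).1.2 ⊓
      Module.End.eigenspace (toEuclideanLin Y) (idx a).1.1 := fun a =>
    hint'.subordinateOrthonormalBasis_subordinate hcard a horth'
  let e := Fintype.equivFin ι
  refine ⟨Matrix.of fun i j => b (e j) i, ?_, fun j =>
    ((idx (e j)).1.2 + Complex.I * (idx (e j)).1.1) / 2, ?_⟩
  · rw [mem_unitaryGroup_iff']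
    ext j k
    have h1 := orthonormal_iff_ite.1 b.orthonormal (e j) (e k)
    rw [PiLp.inner_apply] at h1
    simp only [RCLike.inner_apply] at h1
    rw [mul_apply, one_apply]
    simp only [star_apply, of_apply]
    rw [show (if j = k then (1 : ℂ) else 0) = if e j = e k then 1 else 0 by simp, ← h1]
    exact Finset.sum_congr rfl fun i _ => mul_comm _ _
  · ext i j
    obtain ⟨h1, h2⟩ := Submodule.mem_inf.1 (hb (e j))
    rw [Module.End.mem_eigenspace_iff] at h1 h2
    have h1' := congrFun (congrArg (fun v : EuclideanSpace ℂ ι => (v : ι → ℂ)) h1) i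
    have h2' := congrFun (congrArg (fun v : EuclideanSpace ℂ ι => (v : ι → ℂ)) h2) i
    have hUXY : U = (1 / 2 : ℂ) • (X + Complex.I • Y) := by
      rw [hX, hY, smul_smul, Complex.I_mul_I]
      ext i j
      simp
      ring
    simp only [toLpLin_apply, PiLp.smul_apply, smul_eq_mul] at h1' h2'
    have hcol : (U * Matrix.of fun i j => b (e j) i) i j = (U *ᵥ (b (e j) : ι → ℂ)) i := rfl
    rw [hcol, mul_diagonal, hUXY, smul_mulVec, add_mulVec, smul_mulVec]
    simp only [Pi.smul_apply, Pi.add_apply, smul_eq_mul, of_apply]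
    rw [h1', h2']
    ring

end UnitaryDiagonalization

end Floquet

namespace Floquet

open Matrix Topology

/-! ### Nondegenerate gaps as a polynomial condition -/

section GapPolynomial

variable {ι : Type*} [Fintype ι] [DecidableEq ι]

/-- A symmetric polynomial in the eigenvalues is a polynomial in the elementary symmetric ones.
These are, up to sign, coefficients of the characteristic polynomial, which are polynomials in the
matrix entries. -/
theorem exists_polynomial_of_isSymmetric {P : MvPolynomial ι ℂ} (hP : P.IsSymmetric) :
    ∃ G : MvPolynomial (ι × ι) ℂ, ∀ (M : Matrix ι ι ℂ) (z : ι → ℂ),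
      M.charpoly = ∏ i, (Polynomial.X - Polynomial.C (z i)) →
        MvPolynomial.aeval (fun p : ι × ι => M p.1 p.2) G = MvPolynomial.aeval z P := by
  set n := Fintype.card ι with hn
  set Q := (MvPolynomial.esymmAlgEquiv ι ℂ (n := n) rfl).symm ⟨P, hP⟩ with hQ
  have hPQ : P = MvPolynomial.aeval (fun i : Fin n => MvPolynomial.esymm ι ℂ (i + 1)) Q := by
    have h1 : ((MvPolynomial.esymmAlgEquiv ι ℂ (n := n) rfl) Q : MvPolynomial ι ℂ) = P := by
      rw [hQ, AlgEquiv.apply_symm_apply]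
    rw [← h1]
    exact MvPolynomial.esymmAlgHom_apply Q
  refine ⟨MvPolynomial.aeval (fun i : Fin n =>
    (-1) ^ (i.val + 1) * (charpoly.univ ℂ ι).coeff (n - (i + 1))) Q, fun M z hM => ?_⟩
  rw [hPQ, ← AlgHom.comp_apply, ← AlgHom.comp_apply, MvPolynomial.comp_aeval,
    MvPolynomial.comp_aeval]
  congr 2
  funext i
  have h1 : MvPolynomial.aeval (fun p : ι × ι => M p.1 p.2)
      ((charpoly.univ ℂ ι).coeff (n - (i + 1))) = M.charpoly.coeff (n - (i + 1)) := by
    have := charpoly.univ_coeff_eval₂Hom ι (algebraMap ℂ ℂ) (fun p : ι × ι => M p.1 p.2)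
      (n - (i + 1))
    exact this
  have h2 : M.charpoly.coeff (n - (i + 1)) =
      (-1) ^ (i.val + 1) * (Finset.univ.val.map z).esymm (i + 1) := by
    have hi := i.2
    have h4 := Multiset.prod_X_sub_C_coeff (Finset.univ.val.map z) (k := n - (i + 1))
      (by simp [← hn])
    rw [hM]
    have h5 : n - (n - (i.val + 1)) = i + 1 := by omega
    simp only [Multiset.map_map, Multiset.card_map, Finset.card_val, Finset.card_univ, ← hn,
      h5] at h4
    exact h4
  rw [map_mul, h1, h2, MvPolynomial.aeval_esymm_eq_multiset_esymm, ← mul_assoc, map_pow, map_neg,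
    map_one, ← mul_pow]
  simp

/-- Quadruples that are forced neither to `(a, b, a, b)` nor to `(a, b, b, a)`. -/
def gapQuadruples (ι : Type*) [Fintype ι] [DecidableEq ι] : Finset (ι × ι × ι × ι) :=
  Finset.univ.filter fun q =>
    ¬ ((q.1 = q.2.2.1 ∧ q.2.1 = q.2.2.2) ∨ (q.1 = q.2.2.2 ∧ q.2.1 = q.2.2.1))

/-- The product of all gap differences of the eigenvalues. -/
noncomputable def gapProduct (ι : Type*) [Fintype ι] [DecidableEq ι] : MvPolynomial ι ℂ :=
  ∏ q ∈ gapQuadruples ι, (MvPolynomial.X q.1 * MvPolynomial.X q.2.1 -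
    MvPolynomial.X q.2.2.1 * MvPolynomial.X q.2.2.2)

theorem gapProduct_isSymmetric : (gapProduct ι).IsSymmetric := by
  intro σ
  rw [gapProduct, map_prod]
  simp only [map_sub, map_mul, MvPolynomial.rename_X]
  refine Finset.prod_equiv
    (Equiv.prodCongr σ (Equiv.prodCongr σ (Equiv.prodCongr σ σ))) ?_ ?_
  · intro q
    simp [gapQuadruples]
  · intro q _
    rfl

theorem aeval_gapProduct_ne_zero_iff (z : ι → ℂ) : MvPolynomial.aeval z (gapProduct ι) ≠ 0 ↔
    ∀ a b c d, z a * z b = z c * z d → (a = c ∧ b = d) ∨ (a = d ∧ b = c) := by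
  rw [gapProduct, map_prod, Finset.prod_ne_zero_iff]
  simp only [map_sub, map_mul, MvPolynomial.aeval_X, sub_ne_zero, gapQuadruples, Finset.mem_filter,
    Finset.mem_univ, true_and, Prod.forall]
  exact forall_congr' fun a => forall_congr' fun b => forall_congr' fun c => forall_congr'
    fun d => ⟨fun h h' => by_contra fun h1 => h h1 h', fun h h1 h' => h1 (h h')⟩

theorem charpoly_of_diagonalization {U V : Matrix ι ι ℂ} (hV : V ∈ unitaryGroup ι ℂ) {z : ι → ℂ}
    (h : U * V = V * diagonal z) :
    U.charpoly = ∏ i, (Polynomial.X - Polynomial.C (z i)) := by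
  have : U = V * (diagonal z * star V) := by
    rw [← mul_assoc, ← h, mul_assoc, mem_unitaryGroup_iff.1 hV, mul_one]
  rw [this, charpoly_mul_comm, mul_assoc, mem_unitaryGroup_iff'.1 hV, mul_one, charpoly_diagonal]

/-- On unitary matrices, nondegeneracy of the gaps is the nonvanishing of a polynomial in the
entries. -/
theorem exists_polynomial_gapNondegenerate (ι : Type*) [Fintype ι] [DecidableEq ι] :
    ∃ G : MvPolynomial (ι × ι) ℂ, ∀ U ∈ unitaryGroup ι ℂ,
      MvPolynomial.aeval (fun p : ι × ι => U p.1 p.2) G ≠ 0 ↔ GapNondegenerate U := by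
  obtain ⟨G, hG⟩ := exists_polynomial_of_isSymmetric (gapProduct_isSymmetric (ι := ι))
  refine ⟨G, fun U hU => ⟨fun h V hV z hz => ?_, fun h => ?_⟩⟩
  · rw [hG U z (charpoly_of_diagonalization hV hz)] at h
    exact (aeval_gapProduct_ne_zero_iff z).1 h
  -- Unitarity matters here: without an orthonormal eigenbasis `GapNondegenerate` would hold
  -- vacuously.
  · obtain ⟨V, hV, z, hz⟩ := exists_unitary_diagonalization hU
    rw [hG U z (charpoly_of_diagonalization hV hz)]
    exact (aeval_gapProduct_ne_zero_iff z).2 (h V hV z hz)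

end GapPolynomial

/-- A continuous function that is analytic along lines and does not vanish identically vanishes
only on a null set. -/
theorem measure_zeros_eq_zero {E : Type*} [NormedAddCommGroup E] [NormedSpace ℝ E]
    [FiniteDimensional ℝ E] [MeasurableSpace E] [BorelSpace E] (μ : Measure E)
    [μ.IsAddHaarMeasure] {F : E → ℂ} (hc : Continuous F)
    (hF : ∀ x v, AnalyticOnNhd ℝ (fun t : ℝ => F (x + t • v)) Set.univ) {x₁ : E}
    (h : F x₁ ≠ 0) : μ {x | F x = 0} = 0 := by
  set Z : Set E := {v | F (x₁ + v) = 0} with hZ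
  -- On each line through `x₁` the function is analytic and nonzero at `t = 0`, so its zeros form a
  -- null set.
  have hline : ∀ v, volume {t : ℝ | F (x₁ + t • v) = 0} = 0 := by
    intro v
    have h1 := (hF x₁ v).preimage_zero_mem_codiscrete (x := 0) (by simpa using h)
    have h2 := ae_restrict_le_codiscreteWithin (μ := (volume : Measure ℝ)) MeasurableSet.univ h1
    rw [Measure.restrict_univ, mem_ae_iff] at h2
    refine measure_mono_null ?_ h2
    intro t ht
    simpa using ht
  have hclosed : IsClosed {p : E × ℝ | F (x₁ + p.2 • p.1) = 0} :=
    isClosed_eq (by fun_prop) continuous_const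
  have hprod : (μ.prod volume) {p : E × ℝ | F (x₁ + p.2 • p.1) = 0} = 0 := by
    rw [Measure.measure_prod_null hclosed.measurableSet]
    exact Eventually.of_forall hline
  have hswap : (volume.prod μ) {p : ℝ × E | F (x₁ + p.1 • p.2) = 0} = 0 := by
    rw [← Measure.prod_swap, Measure.map_apply measurable_swap]
    · exact hprod
    · exact (isClosed_eq (by fun_prop) continuous_const :
        IsClosed {p : ℝ × E | F (x₁ + p.1 • p.2) = 0}).measurableSet
  have hae := Measure.measure_ae_null_of_prod_null hswap
  have hne : ∀ᵐ t : ℝ, t ≠ 0 := by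
    simp [ae_iff, measure_singleton]
  -- Fubini, with the order exchanged, gives null sections in `v` for almost every `t`; a single
  -- nonzero `t` suffices, by scaling back.
  obtain ⟨t, ht, ht0⟩ := (hae.and hne).exists
  have hZ0 : μ Z = 0 := by
    have h1 : μ ((fun v => t • v) ⁻¹' Z) = 0 := ht
    rw [Measure.addHaar_preimage_smul μ ht0] at h1
    rcases mul_eq_zero.1 h1 with h2 | h2
    · rw [ENNReal.ofReal_eq_zero] at h2
      exact absurd h2 (not_le.2 (by positivity))
    · exact h2
  rw [← measure_preimage_add μ x₁]
  exact hZ0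

end Floquet

namespace Floquet

open Topology

/-! ### Time averages -/

section Cesaro

theorem tendsto_cesaro_pow {z : ℂ} (hz : ‖z‖ = 1) (hz1 : z ≠ 1) :
    Tendsto (fun M : ℕ => (∑ m ∈ Finset.range M, z ^ m) / (M : ℂ)) atTop (𝓝 0) := by
  have hlim : Tendsto (fun M : ℕ => 2 / ‖z - 1‖ * ((M : ℝ))⁻¹) atTop (𝓝 0) := by
    simpa using (tendsto_inv_atTop_nhds_zero_nat (𝕜 := ℝ)).const_mul (2 / ‖z - 1‖)
  refine squeeze_zero_norm (fun M => ?_) hlim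
  rw [geom_sum_eq hz1, norm_div, norm_div, Complex.norm_natCast, div_eq_mul_inv]
  gcongr
  calc ‖z ^ M - 1‖ ≤ ‖z ^ M‖ + ‖(1 : ℂ)‖ := norm_sub_le _ _
    _ = 2 := by rw [norm_pow, hz, one_pow, norm_one]; norm_num

theorem tendsto_cesaro_one :
    Tendsto (fun M : ℕ => (∑ m ∈ Finset.range M, (1 : ℂ) ^ m) / (M : ℂ)) atTop (𝓝 1) := by
  refine tendsto_const_nhds.congr' ?_
  filter_upwards [eventually_gt_atTop 0] with M hM
  have : (M : ℂ) ≠ 0 := by exact_mod_cast hM.ne'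
  simp [this]

theorem integrableOn_Ico_of_continuous {E : Type*} [NormedAddCommGroup E] {f : ℝ → E}
    (hf : Continuous f) : IntegrableOn f (Set.Ico 0 1) :=
  (hf.continuousOn.integrableOn_Icc).mono_set Set.Ico_subset_Icc_self

/-- Time averages of squared trigonometric sums with distinct frequencies. -/
theorem tendsto_cesaro_integral_norm_sq {K : Type*} [Fintype K] [DecidableEq K] {ω : K → ℂ}
    (hω : ∀ q, ‖ω q‖ = 1) (hinj : Function.Injective ω) {b : K → ℝ → ℂ}
    (hb : ∀ q, Continuous (b q)) :
    Tendsto (fun M : ℕ => (∑ m ∈ Finset.range M,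
      ∫ x in Set.Ico (0 : ℝ) 1, ‖∑ q, b q x * ω q ^ m‖ ^ 2) / (M : ℝ)) atTop
      (𝓝 (∑ q, ∫ x in Set.Ico (0 : ℝ) 1, ‖b q x‖ ^ 2)) := by
  have hexp : ∀ m : ℕ, ((∫ x in Set.Ico (0 : ℝ) 1, ‖∑ q, b q x * ω q ^ m‖ ^ 2 : ℝ) : ℂ) =
      ∑ q, ∑ q', (∫ x in Set.Ico (0 : ℝ) 1, b q x * star (b q' x)) *
        (ω q * star (ω q')) ^ m := by
    intro m
    rw [← integral_complex_ofReal]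
    have h1 : ∀ x, ((‖∑ q, b q x * ω q ^ m‖ ^ 2 : ℝ) : ℂ) =
        ∑ q, ∑ q', b q x * star (b q' x) * (ω q * star (ω q')) ^ m := by
      intro x
      rw [Complex.ofReal_pow, ← Complex.mul_conj', map_sum, Finset.sum_mul_sum]
      refine Finset.sum_congr rfl fun q _ => Finset.sum_congr rfl fun q' _ => ?_
      rw [map_mul, map_pow, mul_pow]
      simp only [Complex.star_def]
      ring
    simp only [h1]
    rw [integral_finsetSum]
    · refine Finset.sum_congr rfl fun q _ => ?_
      rw [integral_finsetSum]
      · exact Finset.sum_congr rfl fun q' _ => integral_mul_const _ _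
      · intro q' _
        exact integrableOn_Ico_of_continuous (((hb q).mul (hb q').star).mul continuous_const)
    · intro q _
      exact integrableOn_Ico_of_continuous (continuous_finsetSum _ fun q' _ =>
        ((hb q).mul (hb q').star).mul continuous_const)
  -- Only `q = q'` survives: for distinct unimodular frequencies the geometric sums stay bounded and
  -- their averages vanish.
  have hC : Tendsto (fun M : ℕ => ∑ q, ∑ q', (∫ x in Set.Ico (0 : ℝ) 1, b q x * star (b q' x)) *
      ((∑ m ∈ Finset.range M, (ω q * star (ω q')) ^ m) / (M : ℂ))) atTop
      (𝓝 (∑ q, ∑ q', (∫ x in Set.Ico (0 : ℝ) 1, b q x * star (b q' x)) *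
        if q = q' then 1 else 0)) := by
    refine tendsto_finsetSum _ fun q _ => tendsto_finsetSum _ fun q' _ => Tendsto.const_mul _ ?_
    have hself : ∀ q, ω q * star (ω q) = 1 := fun q => by
      rw [Complex.star_def, Complex.mul_conj', hω]; simp
    split_ifs with h
    · subst h
      rw [hself]
      exact tendsto_cesaro_one
    · refine tendsto_cesaro_pow (by rw [norm_mul, norm_star, hω, hω, one_mul]) fun h1 => h ?_
      refine hinj ?_
      have h2 := congrArg (· * ω q') h1
      simp only [mul_assoc, one_mul] at h2
      rwa [mul_comm (star _), hself, mul_one] at h2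
  have hval : ∀ M : ℕ, ((((∑ m ∈ Finset.range M,
      ∫ x in Set.Ico (0 : ℝ) 1, ‖∑ q, b q x * ω q ^ m‖ ^ 2) / (M : ℝ) : ℝ)) : ℂ) =
      ∑ q, ∑ q', (∫ x in Set.Ico (0 : ℝ) 1, b q x * star (b q' x)) *
        ((∑ m ∈ Finset.range M, (ω q * star (ω q')) ^ m) / (M : ℂ)) := by
    intro M
    rw [Complex.ofReal_div, Complex.ofReal_sum, Complex.ofReal_natCast]
    simp only [hexp]
    rw [Finset.sum_comm, Finset.sum_div]
    refine Finset.sum_congr rfl fun q _ => ?_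
    rw [Finset.sum_comm, Finset.sum_div]
    refine Finset.sum_congr rfl fun q' _ => ?_
    rw [← Finset.mul_sum, mul_div_assoc]
  have hlimval : ((∑ q, ∫ x in Set.Ico (0 : ℝ) 1, ‖b q x‖ ^ 2 : ℝ) : ℂ) =
      ∑ q, ∑ q', (∫ x in Set.Ico (0 : ℝ) 1, b q x * star (b q' x)) *
        if q = q' then 1 else 0 := by
    rw [Complex.ofReal_sum]
    refine Finset.sum_congr rfl fun q _ => ?_
    simp only [mul_ite, mul_one, mul_zero, Finset.sum_ite_eq, Finset.mem_univ, if_true]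
    rw [← integral_complex_ofReal]
    congr 1
    funext x
    rw [Complex.star_def, Complex.mul_conj']
    push_cast
    rfl
  simp only [← hval, ← hlimval] at hC
  exact (Complex.continuous_re.tendsto _).comp hC

end Cesaro

/-- A function whose period-averaged squared deviations from `g` have a small time average is
approximately periodic. -/
theorem IsApproxPeriodic.of_tendsto_average {f g : ℝ → ℝ} {ε L : ℝ} (hε : 0 < ε) {D : ℕ → ℝ}
    (hD0 : ∀ m, 0 ≤ D m) (hD : ∀ m, D m ≤ ε → GoodPeriod f g ε m)
    (hlim : Tendsto (fun M : ℕ => (∑ m ∈ Finset.range M, D m) / (M : ℝ)) atTop (𝓝 L))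
    (hL : L ≤ ε ^ 2) : IsApproxPeriodic ε f := by
  classical
  refine ⟨g, ?_⟩
  have hlow : Tendsto (fun M : ℕ => 1 - (∑ m ∈ Finset.range M, D m) / (M : ℝ) / ε) atTop
      (𝓝 (1 - L / ε)) := (hlim.div_const ε).const_sub 1
  have hle : 1 - ε ≤ 1 - L / ε := by
    have : L / ε ≤ ε := by
      rw [div_le_iff₀ hε]; linarith [sq ε]
    linarith
  refine hle.trans ?_
  rw [← hlow.liminf_eq]
  refine liminf_le_liminf ?_ hlow.isBoundedUnder_ge ?_
  · filter_upwards [eventually_gt_atTop 0] with M hM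
    have hM' : (0 : ℝ) < M := by exact_mod_cast hM
    rw [le_div_iff₀ hM', sub_mul, one_mul, div_right_comm, div_mul_cancel₀ _ hM'.ne']
    have hsplit := Finset.card_filter_add_card_filter_not (s := Finset.range M)
      (fun m => GoodPeriod f g ε m)
    rw [Finset.card_range] at hsplit
    -- Markov's inequality in time: every bad period contributes at least `ε` to the sum of the `D
    -- m`.
    have hbad : (((Finset.range M).filter fun m => ¬ GoodPeriod f g ε m).card : ℝ) * ε ≤
        ∑ m ∈ Finset.range M, D m := by
      rw [← nsmul_eq_mul]
      refine (Finset.card_nsmul_le_sum _ D ε fun m hm => ?_).trans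
        (Finset.sum_le_sum_of_subset_of_nonneg (Finset.filter_subset _ _) fun m _ _ => hD0 m)
      by_contra hlt
      exact (Finset.mem_filter.1 hm).2 (hD m (not_le.1 hlt).le)
    rw [← le_div_iff₀ hε] at hbad
    have hsplit' : ((((Finset.range M).filter fun m => GoodPeriod f g ε m).card : ℝ)) +
        (((Finset.range M).filter fun m => ¬ GoodPeriod f g ε m).card : ℝ) = M := by
      exact_mod_cast hsplit
    linarith
  -- The real-valued `liminf` is monotone only under boundedness conditions; frequencies of good
  -- periods are at most 1.
  · refine IsCoboundedUnder.of_frequently_le (a := 1) ?_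
    refine (Eventually.of_forall fun M => ?_).frequently
    refine div_le_one_of_le₀ ?_ (Nat.cast_nonneg _)
    exact_mod_cast (Finset.card_filter_le _ _).trans_eq (Finset.card_range M)

end Floquet

namespace Floquet

open Matrix Topology

/-! ### Equilibration to the period of the drive -/

section Stroboscopic

variable {ι : Type*} [Fintype ι] [DecidableEq ι]

theorem sum_sum_eq_diag_add_offDiag (F : ι → ι → ℂ) :
    ∑ k, ∑ l, F k l = ∑ k, F k k + ∑ q : {q : ι × ι // ¬ q.1 = q.2}, F q.1.1 q.1.2 := by
  rw [← Fintype.sum_prod_type' F,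
    ← Fintype.sum_subtype_add_sum_subtype (fun q : ι × ι => q.1 = q.2)]
  congr 1
  refine Fintype.sum_equiv ⟨fun q => q.1.1, fun k => ⟨(k, k), rfl⟩, ?_, fun _ => rfl⟩ _ _ ?_
  · rintro ⟨⟨k, l⟩, h⟩
    dsimp only at h
    subst h
    rfl
  · rintro ⟨⟨k, l⟩, h⟩
    change F k l = F k k
    rw [show k = l from h]

/-- From `|c_k|² |c_l|² ≤ (|c_k|⁴ + |c_l|⁴) / 2`: the first half is summed along rows of `B`, the
second along columns. -/
theorem sum_offDiag_norm_sq_le {B : Matrix ι ι ℂ} (hrow : ∀ k, ∑ l, ‖B k l‖ ^ 2 ≤ 1)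
    (hcol : ∀ l, ∑ k, ‖B k l‖ ^ 2 ≤ 1) (c : ι → ℂ) :
    ∑ q : {q : ι × ι // ¬ q.1 = q.2}, ‖star (c q.1.1) * B q.1.1 q.1.2 * c q.1.2‖ ^ 2 ≤
      ∑ k, ‖c k‖ ^ 4 := by
  have h1 : ∑ q : {q : ι × ι // ¬ q.1 = q.2}, ‖star (c q.1.1) * B q.1.1 q.1.2 * c q.1.2‖ ^ 2 ≤
      ∑ q : ι × ι, ‖star (c q.1) * B q.1 q.2 * c q.2‖ ^ 2 := by
    rw [← Fintype.sum_subtype_add_sum_subtype (fun q : ι × ι => q.1 = q.2)]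
    exact le_add_of_nonneg_left (Finset.sum_nonneg fun _ _ => by positivity)
  have h2 : ∀ q : ι × ι, ‖star (c q.1) * B q.1 q.2 * c q.2‖ ^ 2 ≤
      (‖c q.1‖ ^ 4 / 2 * ‖B q.1 q.2‖ ^ 2 + ‖c q.2‖ ^ 4 / 2 * ‖B q.1 q.2‖ ^ 2) := by
    intro q
    rw [norm_mul, norm_mul, norm_star]
    nlinarith [mul_nonneg (sq_nonneg (‖c q.1‖ ^ 2 - ‖c q.2‖ ^ 2)) (sq_nonneg ‖B q.1 q.2‖)]
  refine h1.trans ((Finset.sum_le_sum fun q _ => h2 q).trans ?_)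
  rw [Finset.sum_add_distrib, Fintype.sum_prod_type, Fintype.sum_prod_type_right]
  simp only [← Finset.mul_sum]
  calc _ ≤ ∑ k, ‖c k‖ ^ 4 / 2 * 1 + ∑ k, ‖c k‖ ^ 4 / 2 * 1 := by
        gcongr with k _ l _
        · exact hrow k
        · exact hcol l
    _ = ∑ k, ‖c k‖ ^ 4 := by
        rw [← Finset.sum_add_distrib]
        exact Finset.sum_congr rfl fun k _ => by ring

/-- Equilibration: with nondegenerate gaps and a small participation ratio, expectation values
are approximately periodic with the period of the drive. -/
theorem isApproxPeriodic_of_nondegenerate_gaps {z : ι → ℂ} (hz : ∀ k, ‖z k‖ = 1)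
    (hgap : ∀ a b c d, z a * z b = z c * z d → (a = c ∧ b = d) ∨ (a = d ∧ b = c))
    {B : ℝ → Matrix ι ι ℂ} (hB : ∀ k l, Continuous fun x => B x k l)
    (hrow : ∀ x k, ∑ l, ‖B x k l‖ ^ 2 ≤ 1) (hcol : ∀ x l, ∑ k, ‖B x k l‖ ^ 2 ≤ 1)
    {c : ι → ℂ} {f : ℝ → ℝ}
    (hf : ∀ m : ℕ, ∀ x ∈ Set.Ico (0 : ℝ) 1, f (m + x) =
      (∑ k, ∑ l, star (c k) * B x k l * c l * (star (z k) * z l) ^ m).re)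
    {ε : ℝ} (hε : 0 < ε) (hc : ∑ k, ‖c k‖ ^ 4 ≤ ε ^ 2) : IsApproxPeriodic ε f := by
  set b : {q : ι × ι // ¬ q.1 = q.2} → ℝ → ℂ := fun q x =>
    star (c q.1.1) * B x q.1.1 q.1.2 * c q.1.2 with hb
  set ω : {q : ι × ι // ¬ q.1 = q.2} → ℂ := fun q => star (z q.1.1) * z q.1.2 with hω
  set g : ℝ → ℝ := fun x => (∑ k, star (c k) * B x k k * c k).re with hg
  have hzz : ∀ k, star (z k) * z k = 1 := fun k => by
    rw [Complex.star_def, Complex.conj_mul', hz]; simp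
  have hbc : ∀ q, Continuous (b q) := fun q =>
    (continuous_const.mul (hB _ _)).mul continuous_const
  have hcn : ∀ q, Continuous fun x => ‖b q x‖ ^ 2 := fun q => (hbc q).norm.pow 2
  have hωn : ∀ q, ‖ω q‖ = 1 := fun q => by
    rw [hω, norm_mul, norm_star, hz, hz, one_mul]
  -- Equal frequencies give `z l * z k' = z l' * z k`. Nondegeneracy then forces equal index pairs,
  -- or `k = l`, which is excluded off the diagonal.
  have hωi : Function.Injective ω := by
    rintro ⟨⟨k, l⟩, hkl⟩ ⟨⟨k', l'⟩, hkl'⟩ h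
    dsimp only [hω] at h hkl hkl'
    have h1 : z l * z k' = z l' * z k := by
      linear_combination (z k * z k') * h - z l * z k' * hzz k + z k * z l' * hzz k'
    rcases hgap _ _ _ _ h1 with ⟨rfl, rfl⟩ | ⟨h2, -⟩
    · rfl
    · exact absurd h2.symm hkl
  have hdev : ∀ m : ℕ, ∀ x ∈ Set.Ico (0 : ℝ) 1, f (m + x) - g x =
      (∑ q, b q x * ω q ^ m).re := by
    intro m x hx
    rw [hf m x hx, sum_sum_eq_diag_add_offDiag, Complex.add_re]
    simp only [hzz, one_pow, mul_one, hg, hb, hω]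
    ring
  refine IsApproxPeriodic.of_tendsto_average (g := g) hε (fun m => ?_) (fun m hm => ?_)
    (tendsto_cesaro_integral_norm_sq hωn hωi hbc) ?_
  · exact integral_nonneg fun x => by positivity
  · have hsq : Continuous fun x => |(∑ q, b q x * ω q ^ m).re| ^ 2 :=
      ((Complex.continuous_re.comp (continuous_finsetSum _ fun q _ =>
        (hbc q).mul continuous_const)).abs).pow 2
    have hcongr : Set.EqOn (fun x => |(∑ q, b q x * ω q ^ m).re| ^ 2)
        (fun x : ℝ => |f (m + x) - g x| ^ 2) (Set.Ico 0 1) := fun x hx => by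
      simp only [hdev m x hx]
    refine ⟨(integrableOn_Ico_of_continuous hsq).congr_fun hcongr measurableSet_Ico, ?_⟩
    rw [← setIntegral_congr_fun measurableSet_Ico hcongr]
    refine le_trans (integral_mono (integrableOn_Ico_of_continuous hsq)
      (integrableOn_Ico_of_continuous ((continuous_finsetSum _ fun q _ =>
        (hbc q).mul continuous_const).norm.pow 2)) fun x => ?_) hm
    exact pow_le_pow_left₀ (abs_nonneg _) (Complex.abs_re_le_norm _) 2
  · rw [← integral_finsetSum _ fun q _ => integrableOn_Ico_of_continuous (hcn q)]
    refine le_trans (integral_mono (g := fun _ => ∑ k, ‖c k‖ ^ 4)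
      (integrableOn_Ico_of_continuous (continuous_finsetSum _ fun q _ => hcn q))
      (integrableOn_Ico_of_continuous continuous_const)
      fun x => sum_offDiag_norm_sq_le (hrow x) (hcol x) c) ?_
    simpa using hc

end Stroboscopic

end Floquet

namespace Floquet

open Matrix Topology

/-! ### Quantum dynamics in an eigenbasis of the Floquet operator -/

section Contractions

open scoped Matrix.Norms.L2Operator

variable {ι : Type*} [Fintype ι] [DecidableEq ι]

theorem sum_norm_sq_col_le {A : Matrix ι ι ℂ} (hA : ‖A‖ ≤ 1) (l : ι) :
    ∑ k, ‖A k l‖ ^ 2 ≤ 1 := by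
  have h := l2_opNorm_mulVec A (EuclideanSpace.single l (1 : ℂ))
  rw [PiLp.norm_single, norm_one, mul_one, EuclideanSpace.norm_eq] at h
  have h1 := Real.sqrt_le_one.1 (h.trans hA)
  simpa using h1

theorem sum_norm_sq_row_le {A : Matrix ι ι ℂ} (hA : ‖A‖ ≤ 1) (k : ι) :
    ∑ l, ‖A k l‖ ^ 2 ≤ 1 := by
  have h := sum_norm_sq_col_le (A := Aᴴ) ((l2_opNorm_conjTranspose A).trans_le hA) k
  simpa using h

theorem norm_le_one_of_mem_unitaryGroup {Q : Matrix ι ι ℂ} (hQ : Q ∈ unitaryGroup ι ℂ) :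
    ‖Q‖ ≤ 1 := by
  rcases isEmpty_or_nonempty ι with h | h
  · have : Q = 0 := Subsingleton.elim _ _
    simp [this]
  · exact (CStarRing.norm_of_mem_unitary hQ).le

theorem norm_conj_le_one {A Q : Matrix ι ι ℂ}
    (hA : ‖toEuclideanCLM (n := ι) (𝕜 := ℂ) A‖ = 1) (hQ : Q ∈ unitaryGroup ι ℂ) :
    ‖star Q * A * Q‖ ≤ 1 := by
  have hA' : ‖A‖ ≤ 1 := ((l2_opNorm_toEuclideanCLM A).symm.trans hA).le
  have h1 := norm_le_one_of_mem_unitaryGroup hQ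
  have h2 := norm_le_one_of_mem_unitaryGroup (Unitary.star_mem hQ)
  calc ‖star Q * A * Q‖ ≤ ‖star Q‖ * ‖A‖ * ‖Q‖ :=
        (norm_mul_le _ _).trans (by gcongr; exact norm_mul_le _ _)
    _ ≤ 1 * 1 * 1 := by gcongr
    _ = 1 := by norm_num

theorem continuous_exp_smul (c : ℝ → ℂ) (hc : Continuous c) (H : Matrix ι ι ℂ) :
    Continuous fun x => NormedSpace.exp (c x • H) :=
  (continuous_iff_continuousAt.2 fun X : Matrix ι ι ℂ =>
    (NormedSpace.exp_analytic (𝕂 := ℂ) X).continuousAt).comp (hc.smul continuous_const)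

theorem analyticAt_exp_comp {E : Type*} [NormedAddCommGroup E] [NormedSpace ℝ E]
    {f : E → Matrix ι ι ℂ} {t : E} (hf : AnalyticAt ℝ f t) :
    AnalyticAt ℝ (fun t => NormedSpace.exp (f t)) t :=
  (NormedSpace.exp_analytic (𝕂 := ℝ) (f t)).comp hf

end Contractions

variable {n N : ℕ}

theorem exp_mem_unitaryGroup {ι : Type*} [Fintype ι] [DecidableEq ι] {H : Matrix ι ι ℂ}
    (hH : H.IsHermitian) (d : ℝ) :
    NormedSpace.exp ((-Complex.I * (d : ℂ)) • H) ∈ unitaryGroup ι ℂ := by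
  rw [mem_unitaryGroup_iff, star_eq_conjTranspose, ← exp_conjTranspose, conjTranspose_smul, hH.eq]
  have : star (-Complex.I * (d : ℂ)) • H = -((-Complex.I * (d : ℂ)) • H) := by
    rw [← neg_smul]
    congr 1
    simp
  rw [this, exp_neg, mul_nonsing_inv]
  exact (isUnit_iff_isUnit_det _).1 (isUnit_exp _)

theorem evolveWithin_mem_unitaryGroup (T : Schedule n) {H : Fin n → Op N}
    (hH : ∀ j, (H j).IsHermitian) (x : ℝ) :
    evolveWithin T H x ∈ unitaryGroup (Config N) ℂ := by
  refine list_prod_mem fun M hM => ?_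
  rw [List.mem_reverse, List.mem_ofFn] at hM
  obtain ⟨j, rfl⟩ := hM
  exact exp_mem_unitaryGroup (hH j) _

theorem continuous_duration (T : Schedule n) (j : Fin n) : Continuous (duration T j) := by
  unfold duration
  fun_prop

theorem continuous_evolveWithin (T : Schedule n) (H : Fin n → Op N) :
    Continuous (evolveWithin T H) := by
  have h : ∀ L : List (ℝ → Op N), (∀ f ∈ L, Continuous f) →
      Continuous fun x => (L.map fun f => f x).prod := by
    intro L hL
    exact continuous_list_prod L hL
  have h1 := h ((List.ofFn fun j : Fin n => fun x =>
    NormedSpace.exp ((-Complex.I * (duration T j x : ℂ)) • H j)).reverse) (by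
      intro f hf
      rw [List.mem_reverse, List.mem_ofFn] at hf
      obtain ⟨j, rfl⟩ := hf
      exact continuous_exp_smul _ (continuous_const.mul
        (Complex.continuous_ofReal.comp (continuous_duration T j))) _)
  refine h1.congr fun x => ?_
  rw [evolveWithin, List.map_reverse, List.map_ofFn]
  rfl

theorem pow_mul_eq_of_diagonalization {ι : Type*} [Fintype ι] [DecidableEq ι]
    {U V : Matrix ι ι ℂ} {z : ι → ℂ} (h : U * V = V * diagonal z) (m : ℕ) :
    U ^ m * V = V * diagonal (z ^ m) := by
  induction m with
  | zero => simp
  | succ m ih =>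
    rw [pow_succ, mul_assoc, h, ← mul_assoc, ih, mul_assoc, diagonal_mul_diagonal]
    congr 2

theorem norm_eigenvalue_eq_one {ι : Type*} [Fintype ι] [DecidableEq ι] {U V : Matrix ι ι ℂ}
    (hU : U ∈ unitaryGroup ι ℂ) (hV : V ∈ unitaryGroup ι ℂ) {z : ι → ℂ}
    (h : U * V = V * diagonal z) (k : ι) : ‖z k‖ = 1 := by
  have h1 : diagonal z = star V * (U * V) := by
    rw [h, ← mul_assoc, mem_unitaryGroup_iff'.1 hV, one_mul]
  have h2 : diagonal z ∈ unitaryGroup ι ℂ := by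
    rw [h1]; exact mul_mem (Unitary.star_mem hV) (mul_mem hU hV)
  have h3 := congrFun (congrFun (mem_unitaryGroup_iff.1 h2) k) k
  rw [star_eq_conjTranspose, diagonal_conjTranspose, diagonal_mul_diagonal, diagonal_apply_eq,
    one_apply_eq, Pi.star_apply, Complex.star_def, Complex.mul_conj'] at h3
  have h4 : ‖z k‖ ^ 2 = 1 := by exact_mod_cast h3
  exact (pow_eq_one_iff_of_nonneg (norm_nonneg _) two_ne_zero).1 h4

theorem isApproxPeriodic_expectation (T : Schedule n) {H : Fin n → Op N}
    (hH : ∀ j, (H j).IsHermitian) {A : Op N}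
    (hA : ‖toEuclideanCLM (n := Config N) (𝕜 := ℂ) A‖ = 1) {V : Op N}
    (hV : V ∈ unitaryGroup (Config N) ℂ) {z : Config N → ℂ}
    (hz : floquetOp T H * V = V * diagonal z) (hgap : GapNondegenerate (floquetOp T H))
    (φ : Fin N → QubitState) {ε : ℝ} (hε : 0 < ε)
    (hφ : ∑ k, ‖(star V *ᵥ productState φ) k‖ ^ 4 ≤ ε ^ 2) :
    IsApproxPeriodicWith 1 ε (expectation T H A φ) := by
  have hU := evolveWithin_mem_unitaryGroup T hH 1
  set c := star V *ᵥ productState φ with hc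
  set W : ℝ → Op N := fun x => evolveWithin T H x * V with hW
  have hWu : ∀ x, W x ∈ unitaryGroup (Config N) ℂ := fun x =>
    mul_mem (evolveWithin_mem_unitaryGroup T hH x) hV
  have hWc : Continuous W := (continuous_evolveWithin T H).mul continuous_const
  have hBc : Continuous fun x => star (W x) * A * W x := (hWc.star.mul continuous_const).mul hWc
  refine isApproxPeriodic_of_nondegenerate_gaps (norm_eigenvalue_eq_one hU hV hz)
    (hgap V hV z hz) (B := fun x => star (W x) * A * W x) (fun k l => ?_)
    (fun x k => sum_norm_sq_row_le (norm_conj_le_one hA (hWu x)) k)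
    (fun x l => sum_norm_sq_col_le (norm_conj_le_one hA (hWu x)) l) (c := c)
    (fun m x hx => ?_) hε hφ
  · exact (continuous_apply l).comp ((continuous_apply k).comp hBc)
  · have hfract : Int.fract ((m : ℝ) + x) = x := by
      rw [Int.fract_natCast_add, Int.fract_eq_self.2 hx]
    have hfloor : ⌊(m : ℝ) + x⌋₊ = m := by
      rw [add_comm, Nat.floor_add_natCast hx.1, Nat.floor_eq_zero.2 hx.2, zero_add]
    -- The eigenbasis turns the complete periods into phases `z k ^ m`; the evolution inside the
    -- current period goes into `W x`, hence into the observable.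
    have hψ : evolve T H (m + x) *ᵥ productState φ = W x *ᵥ fun k => z k ^ m * c k := by
      have h1 : (fun k => z k ^ m * c k) = diagonal (z ^ m) *ᵥ c := by
        ext k
        rw [mulVec_diagonal]
        rfl
      rw [h1, hc, mulVec_mulVec, mulVec_mulVec, hW, evolve, hfract, hfloor]
      congr 1
      rw [mul_assoc, mul_assoc, ← mul_assoc V, ← pow_mul_eq_of_diagonalization hz,
        mul_assoc _ V, mem_unitaryGroup_iff.1 hV, mul_one]
    have h2 : star (W x *ᵥ fun k => z k ^ m * c k) ⬝ᵥ A *ᵥ (W x *ᵥ fun k => z k ^ m * c k) =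
        ∑ k, ∑ l, star (c k) * (star (W x) * A * W x) k l * c l * (star (z k) * z l) ^ m := by
      rw [star_mulVec, ← dotProduct_mulVec, mulVec_mulVec, mulVec_mulVec, ← star_eq_conjTranspose,
        ← mul_assoc, dotProduct]
      refine Finset.sum_congr rfl fun k _ => ?_
      rw [mulVec, dotProduct, Finset.mul_sum]
      refine Finset.sum_congr rfl fun l _ => ?_
      rw [Pi.star_apply, star_mul', star_pow, mul_pow]
      ring
    rw [← h2]
    simp only [Nat.cast_one, one_mul, expectation, hψ]

end Floquet

namespace Floquet

open Matrix Topology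
open scoped Pointwise

/-! ### Unitary invariance of the Haar qubit -/

section SphereInvariance

variable {E : Type*} [NormedAddCommGroup E] [InnerProductSpace ℝ E]

/-- The action of a linear isometry on the unit sphere. -/
def sphereMap (L : E ≃ₗᵢ[ℝ] E) (x : Metric.sphere (0 : E) 1) : Metric.sphere (0 : E) 1 :=
  ⟨L x, by simp⟩

theorem continuous_sphereMap (L : E ≃ₗᵢ[ℝ] E) : Continuous (sphereMap L) :=
  (L.continuous.comp continuous_subtype_val).subtype_mk _

/-- The spherical measure of a set is a dimensional constant times the volume of the cone over it,
and linear isometries preserve cones and volume. -/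
theorem measurePreserving_sphereMap [FiniteDimensional ℝ E] [MeasurableSpace E] [BorelSpace E]
    (L : E ≃ₗᵢ[ℝ] E) :
    MeasurePreserving (sphereMap L) (volume : Measure E).toSphere
      (volume : Measure E).toSphere := by
  refine ⟨(continuous_sphereMap L).measurable, Measure.ext fun s hs => ?_⟩
  rw [Measure.map_apply (continuous_sphereMap L).measurable hs, Measure.toSphere_apply' _ hs,
    Measure.toSphere_apply' _ ((continuous_sphereMap L).measurable hs)]
  congr 1
  have hset : Set.Ioo (0 : ℝ) 1 • (Subtype.val '' (sphereMap L ⁻¹' s)) =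
      L ⁻¹' (Set.Ioo (0 : ℝ) 1 • (Subtype.val '' s)) := by
    ext v
    simp only [Set.mem_smul, Set.mem_image, Set.mem_preimage]
    constructor
    · rintro ⟨r, hr, _, ⟨y, hy, rfl⟩, rfl⟩
      exact ⟨r, hr, L y, ⟨sphereMap L y, hy, rfl⟩, by simp⟩
    · rintro ⟨r, hr, _, ⟨y, hy, rfl⟩, h⟩
      have hy' : sphereMap L ⟨L.symm y, by simp⟩ = y := by
        ext1
        simp [sphereMap]
      refine ⟨r, hr, L.symm y, ⟨⟨L.symm y, by simp⟩, by rwa [hy'], rfl⟩, ?_⟩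
      rw [← map_smul, h, L.symm_apply_apply]
  rw [hset]
  exact L.measurePreserving.measure_preimage_equiv (f := L.toMeasurableEquiv) _

end SphereInvariance

instance : IsProbabilityMeasure haarQubit := by
  refine ⟨?_⟩
  rw [haarQubit, Measure.smul_apply, smul_eq_mul]
  refine ENNReal.inv_mul_cancel ?_ (measure_ne_top _ _)
  rw [Ne, Measure.measure_univ_eq_zero]
  exact Measure.toSphere_ne_zero _

instance (N : ℕ) : IsProbabilityMeasure (haarProduct N) := by
  unfold haarProduct
  infer_instance

theorem integral_haarQubit_comp_sphereMap
    (L : EuclideanSpace ℂ (Fin 2) ≃ₗᵢ[ℝ] EuclideanSpace ℂ (Fin 2)) {F : QubitState → ℝ}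
    (hF : Continuous F) : ∫ φ, F (sphereMap L φ) ∂haarQubit = ∫ φ, F φ ∂haarQubit := by
  have h : MeasurePreserving (sphereMap L) haarQubit haarQubit :=
    (measurePreserving_sphereMap L).smul_measure _
  rw [← h.map_eq, integral_map h.measurable.aemeasurable hF.aestronglyMeasurable, h.map_eq]

/-! ### Fourth moments of one qubit -/

section Moments

/-- The rotation of `ℂ²` with first row `(α, β)`. -/
theorem exists_isometry_first_row {α β : ℂ} (h : ‖α‖ ^ 2 + ‖β‖ ^ 2 = 1) :
    ∃ L : EuclideanSpace ℂ (Fin 2) ≃ₗᵢ[ℝ] EuclideanSpace ℂ (Fin 2),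
      ∀ v, L v 0 = α * v 0 + β * v 1 := by
  let M : Matrix (Fin 2) (Fin 2) ℂ := !![α, β; -star β, star α]
  let f : EuclideanSpace ℂ (Fin 2) →ₗ[ℝ] EuclideanSpace ℂ (Fin 2) :=
    (toEuclideanLin M).restrictScalars ℝ
  have h0 : ∀ v, f v 0 = α * v 0 + β * v 1 := fun v => by
    simp [f, M, toLpLin_apply, dotProduct, Fin.sum_univ_two]
  have h1 : ∀ v, f v 1 = -star β * v 0 + star α * v 1 := fun v => by
    simp [f, M, toLpLin_apply, dotProduct, Fin.sum_univ_two]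
  have hf : ∀ v, ‖f v‖ = ‖v‖ := by
    intro v
    rw [EuclideanSpace.norm_eq, EuclideanSpace.norm_eq, Fin.sum_univ_two, Fin.sum_univ_two, h0, h1]
    congr 1
    simp only [← Complex.normSq_eq_norm_sq] at h ⊢
    simp only [Complex.normSq_apply, Complex.add_re, Complex.add_im, Complex.mul_re,
      Complex.mul_im, Complex.neg_re, Complex.neg_im, Complex.star_def, Complex.conj_re,
      Complex.conj_im] at h ⊢
    linear_combination ((v 0).re * (v 0).re + (v 0).im * (v 0).im + (v 1).re * (v 1).re +
      (v 1).im * (v 1).im) * h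
  exact ⟨LinearIsometry.toLinearIsometryEquiv ⟨f, hf⟩ rfl, h0⟩

theorem integrable_of_continuous {X : Type*} [TopologicalSpace X] [CompactSpace X]
    [MeasurableSpace X] [OpensMeasurableSpace X] (μ : Measure X) [IsFiniteMeasure μ]
    {f : X → ℝ} (hf : Continuous f) : Integrable f μ :=
  hf.integrable_of_hasCompactSupport (HasCompactSupport.of_compactSpace f)

theorem continuous_qubit_apply (i : Fin 2) :
    Continuous fun φ : QubitState => (φ : EuclideanSpace ℂ (Fin 2)) i :=
  (EuclideanSpace.proj (𝕜 := ℂ) i).continuous.comp continuous_subtype_val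

theorem continuous_qubit_form (α β : ℂ) : Continuous fun φ : QubitState =>
    ‖α * (φ : EuclideanSpace ℂ (Fin 2)) 0 + β * (φ : EuclideanSpace ℂ (Fin 2)) 1‖ ^ 4 :=
  ((continuous_const.mul (continuous_qubit_apply 0)).add
    (continuous_const.mul (continuous_qubit_apply 1))).norm.pow 4

theorem integral_unit_form {α β : ℂ} (h : ‖α‖ ^ 2 + ‖β‖ ^ 2 = 1) :
    ∫ φ : QubitState, ‖α * (φ : EuclideanSpace ℂ (Fin 2)) 0 +
      β * (φ : EuclideanSpace ℂ (Fin 2)) 1‖ ^ 4 ∂haarQubit =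
    ∫ φ : QubitState, ‖(φ : EuclideanSpace ℂ (Fin 2)) 0‖ ^ 4 ∂haarQubit := by
  obtain ⟨L, hL⟩ := exists_isometry_first_row h
  have hc : Continuous fun φ : QubitState => ‖(φ : EuclideanSpace ℂ (Fin 2)) 0‖ ^ 4 :=
    (continuous_qubit_apply 0).norm.pow 4
  rw [← integral_haarQubit_comp_sphereMap L hc]
  simp only [sphereMap, hL]

/-- Up to scaling, the six linear forms are overlaps with the eigenvectors of the three Pauli
matrices, which form a projective 2-design. This yields the fourth moment from invariance alone,
with no integral over the sphere to compute. -/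
theorem fourth_power_identity (x y : ℂ) :
    ‖x + y‖ ^ 4 + ‖x + -1 * y‖ ^ 4 + ‖x + Complex.I * y‖ ^ 4 + ‖x + -Complex.I * y‖ ^ 4 +
      4 * ‖x‖ ^ 4 + 4 * ‖y‖ ^ 4 = 8 * (‖x‖ ^ 2 + ‖y‖ ^ 2) ^ 2 := by
  have h4 : ∀ w : ℂ, ‖w‖ ^ 4 = (Complex.normSq w) ^ 2 := fun w => by
    rw [Complex.normSq_eq_norm_sq]; ring
  simp only [h4, ← Complex.normSq_eq_norm_sq]
  simp only [Complex.normSq_apply, Complex.add_re, Complex.add_im, Complex.mul_re,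
    Complex.mul_im, Complex.neg_re, Complex.neg_im, Complex.I_re, Complex.I_im, Complex.one_re,
    Complex.one_im]
  ring

theorem integral_norm_pow_four :
    ∫ φ : QubitState, ‖(φ : EuclideanSpace ℂ (Fin 2)) 0‖ ^ 4 ∂haarQubit = 1 / 3 := by
  set m := ∫ φ : QubitState, ‖(φ : EuclideanSpace ℂ (Fin 2)) 0‖ ^ 4 ∂haarQubit with hm
  have hhalf : ‖((1 / √2 : ℝ) : ℂ)‖ ^ 2 = 1 / 2 := by
    rw [Complex.norm_real, Real.norm_of_nonneg (by positivity), div_pow, Real.sq_sqrt] <;> norm_num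
  have hform : ∀ u : ℂ, ‖u‖ = 1 → ∫ φ : QubitState, ‖(φ : EuclideanSpace ℂ (Fin 2)) 0 +
      u * (φ : EuclideanSpace ℂ (Fin 2)) 1‖ ^ 4 ∂haarQubit = 4 * m := by
    intro u hu
    have h1 := integral_unit_form (α := ((1 / √2 : ℝ) : ℂ)) (β := ((1 / √2 : ℝ) : ℂ) * u)
      (by rw [norm_mul, hu, mul_one, hhalf]; norm_num)
    have h2 : ∀ x y : ℂ, ‖((1 / √2 : ℝ) : ℂ) * x + ((1 / √2 : ℝ) : ℂ) * u * y‖ ^ 4 =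
        1 / 4 * ‖x + u * y‖ ^ 4 := by
      intro x y
      rw [mul_assoc, ← mul_add, norm_mul, mul_pow,
        show ‖((1 / √2 : ℝ) : ℂ)‖ ^ 4 = (‖((1 / √2 : ℝ) : ℂ)‖ ^ 2) ^ 2 by ring, hhalf]
      norm_num
    simp only [h2] at h1
    rw [integral_const_mul, ← hm] at h1
    linarith
  have hy : ∫ φ : QubitState, ‖(φ : EuclideanSpace ℂ (Fin 2)) 1‖ ^ 4 ∂haarQubit = m := by
    have h1 := integral_unit_form (α := 0) (β := 1) (by simp)
    simpa using h1
  have hi : ∀ u : ℂ, Integrable (fun φ : QubitState => ‖(φ : EuclideanSpace ℂ (Fin 2)) 0 +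
      u * (φ : EuclideanSpace ℂ (Fin 2)) 1‖ ^ 4) haarQubit := fun u =>
    integrable_of_continuous _ (by simpa using continuous_qubit_form 1 u)
  have hi0 : ∀ i, Integrable (fun φ : QubitState =>
      4 * ‖(φ : EuclideanSpace ℂ (Fin 2)) i‖ ^ 4) haarQubit := fun i =>
    integrable_of_continuous _ (continuous_const.mul ((continuous_qubit_apply i).norm.pow 4))
  have hnorm : ∀ φ : QubitState, ‖(φ : EuclideanSpace ℂ (Fin 2)) 0‖ ^ 2 +
      ‖(φ : EuclideanSpace ℂ (Fin 2)) 1‖ ^ 2 = 1 := by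
    intro φ
    have h1 : ‖(φ : EuclideanSpace ℂ (Fin 2))‖ = 1 := by simp
    have h2 := EuclideanSpace.norm_sq_eq (φ : EuclideanSpace ℂ (Fin 2))
    rw [h1, Fin.sum_univ_two] at h2
    linarith
  have htotal : ∑ i : Fin 4, ∫ φ : QubitState, ‖(φ : EuclideanSpace ℂ (Fin 2)) 0 +
        ![1, -1, Complex.I, -Complex.I] i * (φ : EuclideanSpace ℂ (Fin 2)) 1‖ ^ 4 ∂haarQubit +
      ∑ i : Fin 2, ∫ φ : QubitState, 4 * ‖(φ : EuclideanSpace ℂ (Fin 2)) i‖ ^ 4 ∂haarQubit = 8 := by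
    rw [← integral_finsetSum _ fun i _ => hi _, ← integral_finsetSum _ fun i _ => hi0 i,
      ← integral_add (integrable_finsetSum _ fun i _ => hi _)
        (integrable_finsetSum _ fun i _ => hi0 i)]
    have h8 : ∀ φ : QubitState, (∑ i : Fin 4, ‖(φ : EuclideanSpace ℂ (Fin 2)) 0 +
        ![1, -1, Complex.I, -Complex.I] i * (φ : EuclideanSpace ℂ (Fin 2)) 1‖ ^ 4) +
        ∑ i : Fin 2, 4 * ‖(φ : EuclideanSpace ℂ (Fin 2)) i‖ ^ 4 = 8 := by
      intro φ
      have h1 := fourth_power_identity ((φ : EuclideanSpace ℂ (Fin 2)) 0)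
        ((φ : EuclideanSpace ℂ (Fin 2)) 1)
      rw [hnorm, one_pow, mul_one] at h1
      rw [Fin.sum_univ_four, Fin.sum_univ_two, ← h1]
      simp
      ring
    simp only [h8]
    simp
  -- Each of the four mixed forms contributes `4 * m`, as does each of the two coordinates with its
  -- weight 4, so `24 * m = 8`.
  rw [Fin.sum_univ_four, Fin.sum_univ_two, integral_const_mul, integral_const_mul, hy,
    hform _ (by simp), hform _ (by simp), hform _ (by simp), hform _ (by simp), ← hm] at htotal
  linarith

theorem integral_qubit_form (α β : ℂ) :
    ∫ φ : QubitState, ‖α * (φ : EuclideanSpace ℂ (Fin 2)) 0 +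
      β * (φ : EuclideanSpace ℂ (Fin 2)) 1‖ ^ 4 ∂haarQubit =
    1 / 3 * (‖α‖ ^ 2 + ‖β‖ ^ 2) ^ 2 := by
  by_cases h : ‖α‖ ^ 2 + ‖β‖ ^ 2 = 0
  · have hα : α = 0 := by
      have : ‖α‖ ^ 2 = 0 := by linarith [sq_nonneg ‖α‖, sq_nonneg ‖β‖]
      simpa using this
    have hβ : β = 0 := by
      have : ‖β‖ ^ 2 = 0 := by linarith [sq_nonneg ‖α‖, sq_nonneg ‖β‖]
      simpa using this
    simp [hα, hβ]
  · set r := √(‖α‖ ^ 2 + ‖β‖ ^ 2) with hr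
    have hr2 : r ^ 2 = ‖α‖ ^ 2 + ‖β‖ ^ 2 := Real.sq_sqrt (by positivity)
    have hr0 : 0 < r := Real.sqrt_pos.2 (lt_of_le_of_ne (by positivity) (Ne.symm h))
    have hrC : (r : ℂ) ≠ 0 := by exact_mod_cast hr0.ne'
    have h1 := integral_unit_form (α := α / r) (β := β / r) (by
      rw [norm_div, norm_div, Complex.norm_real, Real.norm_of_nonneg hr0.le, div_pow, div_pow,
        ← add_div, hr2, div_self h])
    rw [integral_norm_pow_four] at h1
    have h2 : ∀ x y : ℂ, ‖α * x + β * y‖ ^ 4 = r ^ 4 * ‖α / r * x + β / r * y‖ ^ 4 := by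
      intro x y
      have : α * x + β * y = r * (α / r * x + β / r * y) := by field_simp
      rw [this, norm_mul, Complex.norm_real, Real.norm_of_nonneg hr0.le, mul_pow]
    simp only [h2]
    rw [integral_const_mul, h1, ← hr2]
    ring

end Moments

end Floquet

/-! ### Participation ratio of random product states -/

namespace Floquet

open Matrix Topology

variable {n N : ℕ}

theorem sum_config_succ {M : Type*} [AddCommMonoid M] (f : Config (N + 1) → M) :
    ∑ s, f s = ∑ s : Config N, f (Fin.cons 0 s) + ∑ s : Config N, f (Fin.cons 1 s) := by
  rw [← (Fin.consEquiv fun _ : Fin (N + 1) => Fin 2).sum_comp f, Fintype.sum_prod_type,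
    Fin.sum_univ_two]
  rfl

theorem continuous_productState (s : Config N) :
    Continuous fun φ : Fin N → QubitState => productState φ s :=
  continuous_finsetProd _ fun l _ => (continuous_qubit_apply (s l)).comp (continuous_apply l)

theorem continuous_dotProduct_productState (v : Config N → ℂ) :
    Continuous fun φ : Fin N → QubitState => v ⬝ᵥ productState φ :=
  continuous_finsetSum _ fun s _ => continuous_const.mul (continuous_productState s)

theorem continuous_norm_dotProduct_pow_four (v : Config N → ℂ) :
    Continuous fun φ : Fin N → QubitState => ‖v ⬝ᵥ productState φ‖ ^ 4 :=
  (continuous_dotProduct_productState v).norm.pow 4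

theorem dotProduct_productState_cons (v : Config (N + 1) → ℂ) (q : QubitState)
    (φ : Fin N → QubitState) :
    v ⬝ᵥ productState (Fin.cons q φ : Fin (N + 1) → QubitState) =
      ((fun s => v (Fin.cons 0 s)) ⬝ᵥ productState φ) * (q : EuclideanSpace ℂ (Fin 2)) 0 +
      ((fun s => v (Fin.cons 1 s)) ⬝ᵥ productState φ) * (q : EuclideanSpace ℂ (Fin 2)) 1 := by
  simp only [dotProduct, productState, sum_config_succ, Fin.prod_univ_succ, Fin.cons_zero,
    Fin.cons_succ, Finset.sum_mul]
  congr 1 <;> exact Finset.sum_congr rfl fun s _ => by ring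

theorem integral_haarProduct_succ {F : (Fin (N + 1) → QubitState) → ℝ} (hF : Continuous F) :
    ∫ φ, F φ ∂haarProduct (N + 1) =
      ∫ φ, ∫ q, F (Fin.cons q φ) ∂haarQubit ∂haarProduct N := by
  have hmp := measurePreserving_piFinSuccAbove
    (fun _ : Fin (N + 1) => haarQubit) 0
  have h1 : ∀ p : QubitState × (Fin N → QubitState),
      (MeasurableEquiv.piFinSuccAbove (fun _ : Fin (N + 1) => QubitState) 0).symm p =
        Fin.cons p.1 p.2 := by
    intro p
    simp [MeasurableEquiv.piFinSuccAbove, Fin.insertNthEquiv]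
  have hcons : Continuous fun p : QubitState × (Fin N → QubitState) =>
      F (Fin.cons p.1 p.2) := by
    refine hF.comp (continuous_pi fun i => ?_)
    refine Fin.cases ?_ (fun j => ?_) i
    · exact continuous_fst
    · exact (continuous_apply j).comp continuous_snd
  have h2 := hmp.symm.integral_comp' F
  simp only [h1] at h2
  rw [haarProduct, ← h2]
  exact integral_prod_symm _ (integrable_of_continuous _ hcons)

/-- Integrating out one qubit produces a factor `1/3` and the square of a sum of two terms. A
weighted Cauchy-Schwarz inequality removes the cross term, so that the induction needs only fourth
moments on the shorter chain; with weights `a` and `b` the bounds recombine exactly to `(a + b)²`.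
-/
theorem integral_productState_le (v : Config N → ℂ) :
    ∫ φ, ‖v ⬝ᵥ productState φ‖ ^ 4 ∂haarProduct N ≤ (1 / 3) ^ N * (∑ s, ‖v s‖ ^ 2) ^ 2 := by
  induction N with
  | zero =>
    have h1 : ∀ φ : Fin 0 → QubitState, ‖v ⬝ᵥ productState φ‖ ^ 4 = (∑ s, ‖v s‖ ^ 2) ^ 2 := by
      intro φ
      simp only [dotProduct, productState, Finset.univ_eq_empty, Finset.prod_empty, mul_one,
        Fintype.sum_unique]
      ring
    simp [h1]
  | succ N ih =>
    rw [integral_haarProduct_succ (continuous_norm_dotProduct_pow_four v)]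
    simp only [dotProduct_productState_cons, integral_qubit_form]
    set v₀ : Config N → ℂ := fun s => v (Fin.cons 0 s) with hv₀
    set v₁ : Config N → ℂ := fun s => v (Fin.cons 1 s) with hv₁
    set a := ∑ s, ‖v₀ s‖ ^ 2 with ha
    set b := ∑ s, ‖v₁ s‖ ^ 2 with hb
    have ha0 : 0 ≤ a := Finset.sum_nonneg fun _ _ => by positivity
    have hb0 : 0 ≤ b := Finset.sum_nonneg fun _ _ => by positivity
    have hzero : ∀ w : Config N → ℂ, ∑ s, ‖w s‖ ^ 2 = 0 → ∀ φ, w ⬝ᵥ productState φ = 0 := by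
      intro w hw φ
      have h1 := (Finset.sum_eq_zero_iff_of_nonneg fun s _ => by positivity).1 hw
      have h2 : w = 0 := funext fun s => by simpa using h1 s (Finset.mem_univ s)
      rw [h2, zero_dotProduct]
    have hcs : ∀ x y : ℝ, (a = 0 → x = 0) → (b = 0 → y = 0) →
        (x + y) ^ 2 ≤ (a + b) * (x ^ 2 / a + y ^ 2 / b) := by
      intro x y hx hy
      rcases ha0.eq_or_lt with h | h
      · rw [hx h.symm, ← h]
        rcases hb0.eq_or_lt with h' | h'
        · simp [hy h'.symm]
        · apply le_of_eq
          field_simp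
          ring
      · rcases hb0.eq_or_lt with h' | h'
        · rw [hy h'.symm, ← h']
          apply le_of_eq
          field_simp
          ring
        · rw [← sub_nonneg]
          have : (a + b) * (x ^ 2 / a + y ^ 2 / b) - (x + y) ^ 2 = (b * x - a * y) ^ 2 / (a * b) := by
            field_simp
            ring
          rw [this]
          positivity
    have hpoint : ∀ φ : Fin N → QubitState,
        1 / 3 * (‖v₀ ⬝ᵥ productState φ‖ ^ 2 + ‖v₁ ⬝ᵥ productState φ‖ ^ 2) ^ 2 ≤
          1 / 3 * (a + b) / a * ‖v₀ ⬝ᵥ productState φ‖ ^ 4 +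
          1 / 3 * (a + b) / b * ‖v₁ ⬝ᵥ productState φ‖ ^ 4 := by
      intro φ
      have h1 := hcs (‖v₀ ⬝ᵥ productState φ‖ ^ 2) (‖v₁ ⬝ᵥ productState φ‖ ^ 2)
        (fun h => by simp [hzero v₀ h φ]) (fun h => by simp [hzero v₁ h φ])
      calc _ ≤ 1 / 3 * ((a + b) * ((‖v₀ ⬝ᵥ productState φ‖ ^ 2) ^ 2 / a +
            (‖v₁ ⬝ᵥ productState φ‖ ^ 2) ^ 2 / b)) := by gcongr
        _ = _ := by ring
    have hint : ∀ w : Config N → ℂ,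
        Integrable (fun φ => ‖w ⬝ᵥ productState φ‖ ^ 4) (haarProduct N) := fun w =>
      integrable_of_continuous _ (continuous_norm_dotProduct_pow_four w)
    have hcont : ∀ w : Config N → ℂ, Continuous fun φ => ‖w ⬝ᵥ productState φ‖ ^ 2 := fun w =>
      (continuous_dotProduct_productState w).norm.pow 2
    -- Since `0 / 0 = 0`, this also holds at `x = 0`, so vanishing `a` or `b` needs no separate case
    -- in the chain of inequalities.
    have hself : ∀ x : ℝ, x / x * x = x := fun x => by
      by_cases h : x = 0
      · simp [h]
      · field_simp
    calc _ ≤ ∫ φ, (1 / 3 * (a + b) / a * ‖v₀ ⬝ᵥ productState φ‖ ^ 4 +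
          1 / 3 * (a + b) / b * ‖v₁ ⬝ᵥ productState φ‖ ^ 4) ∂haarProduct N :=
          integral_mono (integrable_of_continuous _
            (continuous_const.mul (((hcont v₀).add (hcont v₁)).pow 2)))
            (((hint v₀).const_mul _).add ((hint v₁).const_mul _)) hpoint
      _ = 1 / 3 * (a + b) / a * ∫ φ, ‖v₀ ⬝ᵥ productState φ‖ ^ 4 ∂haarProduct N +
          1 / 3 * (a + b) / b * ∫ φ, ‖v₁ ⬝ᵥ productState φ‖ ^ 4 ∂haarProduct N := by
          rw [integral_add ((hint v₀).const_mul _) ((hint v₁).const_mul _), integral_const_mul,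
            integral_const_mul]
      _ ≤ 1 / 3 * (a + b) / a * ((1 / 3) ^ N * a ^ 2) +
          1 / 3 * (a + b) / b * ((1 / 3) ^ N * b ^ 2) := by
          gcongr
          · exact ih v₀
          · exact ih v₁
      _ = (1 / 3) ^ (N + 1) * (a + b) * (a / a * a + b / b * b) := by ring
      _ = (1 / 3) ^ (N + 1) * (∑ s, ‖v s‖ ^ 2) ^ 2 := by
          rw [hself, hself, sum_config_succ (fun s => ‖v s‖ ^ 2)]
          ring

/-- Each of the `2 ^ N` eigenvectors is a unit vector and contributes at most `(1/3) ^ N`. -/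
theorem integral_participation_le {V : Op N} (hV : V ∈ unitaryGroup (Config N) ℂ) :
    ∫ φ, ∑ k, ‖(star V *ᵥ productState φ) k‖ ^ 4 ∂haarProduct N ≤ (2 / 3) ^ N := by
  have hrow : ∀ k, ∑ s, ‖star V k s‖ ^ 2 = 1 := by
    intro k
    have h1 := congrFun (congrFun (mem_unitaryGroup_iff.1 (Unitary.star_mem hV)) k) k
    rw [star_star, mul_apply, one_apply_eq] at h1
    have h2 : ∀ s, star V k s * V s k = ((‖star V k s‖ ^ 2 : ℝ) : ℂ) := by
      intro s
      rw [star_apply, norm_star, Complex.star_def, Complex.conj_mul']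
      push_cast
      rfl
    simp only [h2] at h1
    exact_mod_cast h1
  have hint : ∀ k, Integrable (fun φ => ‖(star V *ᵥ productState φ) k‖ ^ 4) (haarProduct N) :=
    fun k => integrable_of_continuous _ (continuous_norm_dotProduct_pow_four fun s => star V k s)
  rw [integral_finsetSum _ fun k _ => hint k]
  calc _ ≤ ∑ k : Config N, ((1 / 3 : ℝ)) ^ N := by
        refine Finset.sum_le_sum fun k _ => ?_
        have := integral_productState_le fun s => star V k s
        rw [hrow, one_pow, mul_one] at this
        exact this
    _ = (2 / 3) ^ N := by
        rw [Finset.sum_const, Finset.card_univ, nsmul_eq_mul, Fintype.card_pi, Finset.prod_const,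
          Fintype.card_fin, Finset.card_univ, Fintype.card_fin]
        push_cast
        rw [← mul_pow]
        norm_num

/-- The rate `c` in the resolution `e^{-cN}`. -/
noncomputable def resolutionRate : ℝ := Real.log (3 / 2) / 3

theorem resolutionRate_pos : 0 < resolutionRate :=
  div_pos (Real.log_pos (by norm_num)) (by norm_num)

theorem exp_resolutionRate_pow (N : ℕ) :
    Real.exp (-resolutionRate * N) ^ 3 = (2 / 3) ^ N := by
  rw [← Real.exp_nat_mul, resolutionRate]
  have : ((3 : ℕ) : ℝ) * (-(Real.log (3 / 2) / 3) * N) = N * Real.log (2 / 3) := by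
    rw [show (2 / 3 : ℝ) = (3 / 2)⁻¹ by norm_num, Real.log_inv]
    push_cast
    ring
  rw [this, Real.exp_nat_mul, Real.exp_log (by norm_num)]

/-- Nondegenerate quasi-energy gaps exclude discrete time-crystalline behaviour. -/
theorem not_hasDTC_of_gapNondegenerate (T : Schedule n) {H : Fin n → Op N}
    (hH : ∀ j, (H j).IsHermitian) (hgap : GapNondegenerate (floquetOp T H)) :
    ¬ HasDTC resolutionRate T H := by
  rintro ⟨A, -, hA, ε, hε, hprob⟩
  refine absurd hprob (not_lt.2 ?_)
  obtain ⟨V, hV, z, hz⟩ := exists_unitary_diagonalization (evolveWithin_mem_unitaryGroup T hH 1)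
  set ε₀ := Real.exp (-resolutionRate * N) with hε₀
  have hε₀pos : 0 < ε₀ := Real.exp_pos _
  set X : (Fin N → QubitState) → ℝ := fun φ => ∑ k, ‖(star V *ᵥ productState φ) k‖ ^ 4 with hX
  have hXc : Continuous X := continuous_finsetSum _ fun k _ =>
    continuous_norm_dotProduct_pow_four fun s => star V k s
  have hsub : {φ | IsTimeCrystalline ε (expectation T H A φ)} ⊆ {φ | ε₀ ^ 2 ≤ X φ} := by
    intro φ hφ
    by_contra hlt
    refine hφ.1 (isApproxPeriodic_expectation T hH hA hV hz hgap φ (hε₀pos.trans_le hε) ?_)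
    exact (not_le.1 hlt).le.trans (pow_le_pow_left₀ hε₀pos.le hε 2)
  refine (measure_mono hsub).trans ?_
  have hmarkov := mul_meas_ge_le_integral_of_nonneg (μ := haarProduct N)
    (Eventually.of_forall fun φ => Finset.sum_nonneg fun k _ => by positivity)
    (integrable_of_continuous _ hXc) (ε₀ ^ 2)
  -- The mean is at most `(2/3)^N = ε₀³`. The Markov threshold `ε₀²` uses up two of the three powers
  -- and leaves probability `ε₀`; this balance fixes the rate.
  have hle : ε₀ ^ 2 * (haarProduct N).real {φ | ε₀ ^ 2 ≤ X φ} ≤ ε₀ ^ 2 * ε₀ := by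
    refine hmarkov.trans ((integral_participation_le hV).trans_eq ?_)
    rw [← exp_resolutionRate_pow]
    ring
  exact ENNReal.le_ofReal_iff_toReal_le (measure_ne_top _ _) hε₀pos.le |>.2
    (le_of_mul_le_mul_left hle (by positivity))

end Floquet

/-! ### Analyticity of the Floquet operator and the null set -/

namespace Floquet

open Matrix Topology

variable {n N : ℕ}

/-- All factors are 1 at `s = 0`, so to first order their order does not matter and the generators
add up. -/
theorem hasDerivAt_exp_smul_list {A : Type*} [NormedRing A] [NormedAlgebra ℝ A] [CompleteSpace A]
    (L : List A) :
    HasDerivAt (fun s : ℝ => (L.map fun C => NormedSpace.exp (s • C)).prod) L.sum 0 ∧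
      (L.map fun C => NormedSpace.exp ((0 : ℝ) • C)).prod = 1 := by
  induction L with
  | nil => exact ⟨hasDerivAt_const (0 : ℝ) (1 : A), rfl⟩
  | cons C L ih =>
    have h1 : HasDerivAt (fun s : ℝ => NormedSpace.exp (s • C)) C 0 := by
      simpa using hasDerivAt_exp_smul_const (𝕂 := ℝ) C (0 : ℝ)
    refine ⟨(h1.mul ih.1).congr_deriv ?_, ?_⟩
    · rw [ih.2, zero_smul, NormedSpace.exp_zero, mul_one, one_mul, List.sum_cons]
    · rw [List.map_cons, List.prod_cons, ih.2, zero_smul, NormedSpace.exp_zero, mul_one]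

theorem analyticAt_list_prod {E A : Type*} [NormedAddCommGroup E] [NormedSpace ℝ E]
    [NormedRing A] [NormedAlgebra ℝ A] {x : E} (L : List (E → A))
    (hL : ∀ f ∈ L, AnalyticAt ℝ f x) :
    AnalyticAt ℝ (fun y => (L.map fun f => f y).prod) x := by
  induction L with
  | nil => exact analyticAt_const
  | cons f L ih => exact (hL f (by simp)).mul (ih fun g hg => hL g (by simp [hg]))

section MatrixNorm

open scoped Matrix.Norms.L2Operator

theorem analyticAt_matrix_entry {ι E : Type*} [Fintype ι] [DecidableEq ι] [NormedAddCommGroup E]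
    [NormedSpace ℝ E] {x : E} {M : E → Matrix ι ι ℂ} (hM : AnalyticAt ℝ M x) (i j : ι) :
    AnalyticAt ℝ (fun y => M y i j) x :=
  ((LinearMap.toContinuousLinearMap
    (Matrix.entryLinearMap ℝ ℂ i j : Matrix ι ι ℂ →ₗ[ℝ] ℂ)).analyticAt (M x)).comp hM

theorem analyticAt_floquetOp {E : Type*} [NormedAddCommGroup E] [NormedSpace ℝ E]
    (T : Schedule n) {H : E → Fin n → Op N} {x : E}
    (hH : ∀ j, AnalyticAt ℝ (fun y => H y j) x) :
    AnalyticAt ℝ (fun y => floquetOp T (H y)) x := by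
  have h := analyticAt_list_prod (x := x) ((List.ofFn fun j : Fin n => fun y =>
    NormedSpace.exp ((-Complex.I * (duration T j 1 : ℂ)) • H y j)).reverse) (by
      intro f hf
      rw [List.mem_reverse, List.mem_ofFn] at hf
      obtain ⟨j, rfl⟩ := hf
      exact analyticAt_exp_comp ((hH j).fun_const_smul))
  refine h.congr (Eventually.of_forall fun y => ?_)
  dsimp only
  rw [floquetOp, evolveWithin, List.map_reverse, List.map_ofFn]
  rfl

theorem analyticAt_aeval_floquetOp {E : Type*} [NormedAddCommGroup E] [NormedSpace ℝ E]
    [FiniteDimensional ℝ E] (T : Schedule n) {H : E → Fin n → Op N} (hlin : IsLinearMap ℝ H)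
    (G : MvPolynomial (Config N × Config N) ℂ) (x : E) :
    AnalyticAt ℝ (fun y => MvPolynomial.aeval
      (fun p : Config N × Config N => floquetOp T (H y) p.1 p.2) G) x := by
  refine AnalyticAt.aeval_mvPolynomial (fun p => ?_) G
  refine analyticAt_matrix_entry (analyticAt_floquetOp T fun j => ?_) p.1 p.2
  let f : E →ₗ[ℝ] Op N :=
    { toFun := fun y => H y j
      map_add' := fun y z => congrFun (hlin.map_add y z) j
      map_smul' := fun r y => congrFun (hlin.map_smul r y) j }
  exact (LinearMap.toContinuousLinearMap f).analyticAt x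

theorem hasDerivAt_matrix_entry {ι : Type*} [Fintype ι] [DecidableEq ι] {M : ℝ → Matrix ι ι ℂ}
    {M' : Matrix ι ι ℂ} {s : ℝ} (hM : HasDerivAt M M' s) (i j : ι) :
    HasDerivAt (fun s => M s i j) (M' i j) s :=
  (LinearMap.toContinuousLinearMap
    (Matrix.entryLinearMap ℝ ℂ i j : Matrix ι ι ℂ →ₗ[ℝ] ℂ)).hasFDerivAt.comp_hasDerivAt s hM

theorem prod_exp_smul_eq_floquetOp (T : Schedule n) (H : Fin n → Op N) (s : ℝ) :
    (((List.ofFn fun k : Fin n => (-Complex.I * (duration T k 1 : ℂ)) • H k).reverse).map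
      fun C => NormedSpace.exp (s • C)).prod = floquetOp T (s • H) := by
  rw [floquetOp, evolveWithin, List.map_reverse, List.map_ofFn]
  congr 3
  funext k
  exact congrArg NormedSpace.exp (smul_comm _ _ _)

theorem hasDerivAt_floquetOp_smul (T : Schedule n) (H : Fin n → Op N) (i j : Config N) :
    HasDerivAt (fun s : ℝ => floquetOp T (s • H) i j)
      (-Complex.I * (∑ k, (duration T k 1 : ℂ) • H k) i j) 0 := by
  have h1 := (hasDerivAt_exp_smul_list
    (List.ofFn fun k : Fin n => (-Complex.I * (duration T k 1 : ℂ)) • H k).reverse).1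
  simp only [prod_exp_smul_eq_floquetOp] at h1
  refine (hasDerivAt_matrix_entry h1 i j).congr_deriv ?_
  rw [List.sum_reverse, List.sum_ofFn, Matrix.sum_apply, Matrix.sum_apply, Finset.mul_sum]
  exact Finset.sum_congr rfl fun k _ => by simp [mul_assoc]

theorem floquetOp_zero_smul (T : Schedule n) (H : Fin n → Op N) :
    floquetOp T ((0 : ℝ) • H) = 1 := by
  rw [← prod_exp_smul_eq_floquetOp]
  exact (hasDerivAt_exp_smul_list _).2

end MatrixNorm

theorem hamiltonian_periodic (T : Schedule n) (H : Fin n → Op N) (t : ℝ) :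
    hamiltonian T H (t + 1) = hamiltonian T H t := by
  simp only [hamiltonian, Int.fract_add_one]

theorem volume_not_gapNondegenerate_eq_zero {κ : Type*} [Fintype κ] (T : Schedule n)
    {H : EuclideanSpace ℝ κ → Fin n → Op N} (hlin : IsLinearMap ℝ H)
    (hherm : ∀ x j, (H x j).IsHermitian) {x₁ : EuclideanSpace ℝ κ}
    (hx₁ : SumNondegenerate (∑ j, (duration T j 1 : ℂ) • H x₁ j)) :
    volume {x | ¬ GapNondegenerate (floquetOp T (H x))} = 0 := by
  obtain ⟨G, hG⟩ := exists_polynomial_gapNondegenerate (Config N)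
  have hFgap := fun x => hG (floquetOp T (H x)) (evolveWithin_mem_unitaryGroup T (hherm x) 1)
  have hFa := analyticAt_aeval_floquetOp T hlin G
  obtain ⟨s, hs⟩ := exists_gapNondegenerate_of_hasDerivAt
    (U := fun s => floquetOp T (s • H x₁)) (floquetOp_zero_smul T (H x₁))
    (hasDerivAt_floquetOp_smul T (H x₁)) hx₁
  -- By linearity of the family, the rescaled Hamiltonian belongs to the parameter `s • x₁`, which
  -- is the point where the analytic function is nonzero.
  rw [← hlin.map_smul] at hs
  have hzero := measure_zeros_eq_zero volume
    (continuous_iff_continuousAt.2 fun x => (hFa x).continuousAt) (fun x v t _ => by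
      refine (hFa (x + t • v)).comp (f := fun t : ℝ => x + t • v) ?_
      exact analyticAt_const.add (analyticAt_id.smul analyticAt_const)) ((hFgap _).2 hs)
  refine measure_mono_null (fun x hx => ?_) hzero
  by_contra hne
  exact hx ((hFgap x).1 hne)

theorem hasDTC_null_and_unstable {κ : Type} [Fintype κ] (T : Schedule n)
    {H : EuclideanSpace ℝ κ → Fin n → Op N} (hlin : IsLinearMap ℝ H)
    (hherm : ∀ x j, (H x j).IsHermitian) {x₁ : EuclideanSpace ℝ κ}
    (hx₁ : SumNondegenerate (∑ j, (duration T j 1 : ℂ) • H x₁ j)) :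
    volume {x | HasDTC resolutionRate T (H x)} = 0 ∧
      ∀ x₀, UnstableAt (fun x => hamiltonian T (H x)) (fun x => HasDTC resolutionRate T (H x))
        x₀ := by
  have hnull : volume {x | HasDTC resolutionRate T (H x)} = 0 := by
    refine measure_mono_null ?_ (volume_not_gapNondegenerate_eq_zero T hlin hherm hx₁)
    intro x hx hgap
    exact not_hasDTC_of_gapNondegenerate T (hherm x) hgap hx
  refine ⟨hnull, fun x₀ r hr hstable => ?_⟩
  -- Stability would put a ball of positive volume inside the null set; the periodicity condition
  -- holds for every perturbation within the family.
  refine (Metric.measure_closedBall_pos volume x₀ hr).ne' (measure_mono_null ?_ hnull)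
  intro x hx
  refine hstable x hx fun t => ?_
  simp only [hamiltonian_periodic]

/-! ### Hermiticity and linearity of the two families -/

theorem siteOp_isHermitian (l : Fin N) (u : Axis) : (siteOp l u).IsHermitian := by
  ext s s'
  have h1 : (∀ k, k ≠ l → s' k = s k) ↔ ∀ k, k ≠ l → s k = s' k :=
    forall_congr' fun k => forall_congr' fun _ => eq_comm
  have h2 : star (pauli u (s' l) (s l)) = pauli u (s l) (s' l) := by
    generalize s l = a
    generalize s' l = b
    cases u <;> fin_cases a <;> fin_cases b <;> simp [pauli]
  rw [conjTranspose_apply, siteOp, siteOp, ← h2]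
  simp only [h1]
  split_ifs <;> simp

theorem siteOp_mul_siteOp_apply {l m : Fin N} (hlm : l ≠ m) (u v : Axis) (s s' : Config N) :
    (siteOp l u * siteOp m v) s s' =
      if ∀ k, k ≠ l → k ≠ m → s k = s' k then pauli u (s l) (s' l) * pauli v (s m) (s' m)
        else 0 := by
  rw [mul_apply, Finset.sum_eq_single (Function.update s l (s' l))]
  · have h1 : ∀ k, k ≠ l → s k = Function.update s l (s' l) k := fun k hk => by simp [hk]
    have h2 : (∀ k, k ≠ m → Function.update s l (s' l) k = s' k) ↔
        ∀ k, k ≠ l → k ≠ m → s k = s' k := by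
      refine forall_congr' fun k => ?_
      by_cases hk : k = l
      · subst hk; simp
      · simp [hk]
    simp only [siteOp, if_pos h1, h2, Function.update_self, Function.update_of_ne hlm.symm]
    split_ifs <;> simp
  · intro w _ hw
    by_cases h1 : ∀ k, k ≠ l → s k = w k
    · have h2 : ¬ ∀ k, k ≠ m → w k = s' k := by
        intro h
        refine hw (funext fun k => ?_)
        by_cases hk : k = l
        · subst hk; simp [h k hlm]
        · simp [hk, h1 k hk]
      simp only [siteOp, if_neg h2, mul_zero]
    · simp only [siteOp, if_neg h1, zero_mul]
  · simp

theorem siteOp_mul_siteOp_isHermitian {l m : Fin N} (hlm : l ≠ m) (u v : Axis) :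
    (siteOp l u * siteOp m v).IsHermitian := by
  have hcomm : siteOp l u * siteOp m v = siteOp m v * siteOp l u := by
    ext s s'
    rw [siteOp_mul_siteOp_apply hlm, siteOp_mul_siteOp_apply hlm.symm, mul_comm]
    have : (∀ k, k ≠ m → k ≠ l → s k = s' k) ↔ ∀ k, k ≠ l → k ≠ m → s k = s' k :=
      forall_congr' fun k => ⟨fun h h1 h2 => h h2 h1, fun h h1 h2 => h h2 h1⟩
    simp only [this]
  rw [Matrix.IsHermitian, conjTranspose_mul, (siteOp_isHermitian l u).eq,
    (siteOp_isHermitian m v).eq, hcomm]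

theorem bondLeft_ne_bondRight (b : Fin (N - 1)) : bondLeft b ≠ bondRight b := by
  simp [bondLeft, bondRight, Fin.ext_iff]

theorem isHermitian_sum {ι κ : Type*} (s : Finset κ) {M : κ → Matrix ι ι ℂ}
    (h : ∀ k, (M k).IsHermitian) : (∑ k ∈ s, M k).IsHermitian := by
  rw [Matrix.IsHermitian, conjTranspose_sum]
  exact Finset.sum_congr rfl fun k _ => (h k).eq

theorem isHermitian_ofReal_smul {ι : Type*} {M : Matrix ι ι ℂ} (h : M.IsHermitian) (r : ℝ) :
    ((r : ℂ) • M).IsHermitian := by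
  rw [Matrix.IsHermitian, conjTranspose_smul, h.eq, Complex.star_def, Complex.conj_ofReal]

theorem isHermitian_ite_smul {ι : Type*} {M : Matrix ι ι ℂ} (h : M.IsHermitian) (b : Bool)
    (r : ℝ) : ((if b then (r : ℂ) else 0) • M).IsHermitian := by
  split_ifs
  · exact isHermitian_ofReal_smul h r
  · rw [zero_smul]; exact isHermitian_zero

theorem isingPieces_isHermitian (x : EuclideanSpace ℝ (IsingIdx N)) (j : Fin 2) :
    (isingPieces N x j).IsHermitian := by
  fin_cases j
  · exact (isHermitian_sum _ fun l => isHermitian_ofReal_smul (siteOp_isHermitian _ _) _).add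
      (isHermitian_sum _ fun l => isHermitian_ofReal_smul
        (siteOp_mul_siteOp_isHermitian (bondLeft_ne_bondRight l) _ _) _)
  · change (∑ l : Fin N, (x (Sum.inl (Sum.inl l)) : ℂ) • siteOp l Axis.x).IsHermitian
    exact isHermitian_sum _ fun l => isHermitian_ofReal_smul (siteOp_isHermitian _ _) _

theorem isingPieces_isLinearMap : IsLinearMap ℝ (isingPieces N) := by
  refine ⟨fun x y => ?_, fun r x => ?_⟩
  · funext j
    fin_cases j
    · simp only [isingPieces, PiLp.add_apply, Complex.ofReal_add, add_smul,
        Finset.sum_add_distrib]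
      simp
      abel
    · simp [isingPieces, add_smul, Finset.sum_add_distrib]
  · funext j
    fin_cases j
    · simp [isingPieces, Finset.smul_sum, mul_smul]
    · simp [isingPieces, Finset.smul_sum, mul_smul]

theorem chainPieces_isHermitian (α : Fin n → Axis → Bool) (γ : Fin n → Axis → Axis → Bool)
    (x : EuclideanSpace ℝ (ChainIdx n N)) (j : Fin n) :
    (chainPieces N α γ x j).IsHermitian :=
  (isHermitian_sum _ fun _ => isHermitian_sum _ fun _ =>
    isHermitian_ite_smul (siteOp_isHermitian _ _) _ _).add
  (isHermitian_sum _ fun l => isHermitian_sum _ fun _ => isHermitian_sum _ fun _ =>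
    isHermitian_ite_smul (siteOp_mul_siteOp_isHermitian (bondLeft_ne_bondRight l) _ _) _ _)

theorem chainPieces_isLinearMap (α : Fin n → Axis → Bool) (γ : Fin n → Axis → Axis → Bool) :
    IsLinearMap ℝ (chainPieces N α γ) := by
  have hadd : ∀ (b : Bool) (r s : ℝ) (M : Op N), (if b then ((r + s : ℝ) : ℂ) else 0) • M =
      (if b then (r : ℂ) else 0) • M + (if b then (s : ℂ) else 0) • M := by
    intro b r s M
    split_ifs <;> simp [add_smul]
  have hsmul : ∀ (b : Bool) (r s : ℝ) (M : Op N), (if b then ((r * s : ℝ) : ℂ) else 0) • M =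
      r • (if b then (s : ℂ) else 0) • M := by
    intro b r s M
    split_ifs <;> simp [mul_smul]
  refine ⟨fun x y => ?_, fun r x => ?_⟩
  · funext j
    simp only [chainPieces, PiLp.add_apply, hadd, Finset.sum_add_distrib, Pi.add_apply]
    abel
  · funext j
    simp only [chainPieces, PiLp.smul_apply, smul_eq_mul, hsmul, ← Finset.smul_sum, Pi.smul_apply,
      smul_add]

/-! ### Parameters whose period average is the hierarchical chain -/

theorem duration_one (T : Schedule n) (j : Fin n) :
    duration T j 1 = T.t j.succ - T.t j.castSucc := by
  have h1 : T.t j.succ ≤ 1 := by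
    rw [← T.last]
    exact T.strictMono.monotone (Fin.le_last _)
  have h2 : T.t j.castSucc ≤ T.t j.succ := T.strictMono.monotone Fin.castSucc_lt_succ.le
  rw [duration, min_eq_right h1, max_eq_right (sub_nonneg.2 h2)]

theorem duration_one_pos (T : Schedule n) (j : Fin n) : 0 < duration T j 1 := by
  rw [duration_one]
  exact sub_pos.2 (T.strictMono Fin.castSucc_lt_succ)

theorem exists_isingPieces_eq (R : Fin N → ℝ) : ∃ x : EuclideanSpace ℝ (IsingIdx N),
    ∑ j, (duration halves j 1 : ℂ) • isingPieces N x j = hierarchicalChain N R := by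
  -- Each half of the period has weight `1/2`, so all couplings of the target are doubled; the
  -- longitudinal field `2 * R` becomes `4 * R`.
  refine ⟨WithLp.toLp 2 (Sum.elim (Sum.elim (fun l => 2 * R l) fun l => 4 * R l)
    fun b => 2 * R (bondRight b)), ?_⟩
  have h0 : duration halves 0 1 = 1 / 2 := by
    rw [duration_one]; simp [halves]
  have h1 : duration halves 1 1 = 1 / 2 := by
    rw [duration_one]; simp [halves]; norm_num
  have hs : ∀ (r s : ℝ) (M : Op N), r * s = 2 * s → ((1 / 2 : ℝ) : ℂ) • ((r * s : ℝ) : ℂ) • M =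
      (s : ℂ) • M := by
    intro r s M h
    rw [smul_smul, ← Complex.ofReal_mul, h]
    congr 2
    ring
  have hs' : ∀ (s : ℝ) (M : Op N), ((1 / 2 : ℝ) : ℂ) • ((4 * s : ℝ) : ℂ) • M =
      ((2 * s : ℝ) : ℂ) • M := by
    intro s M
    rw [smul_smul, ← Complex.ofReal_mul]
    congr 2
    ring
  rw [Fin.sum_univ_two, h0, h1]
  simp only [isingPieces, cons_val_zero, cons_val_one, Sum.elim_inl, Sum.elim_inr, smul_add,
    Finset.smul_sum, hs', hs 2 _ _ rfl, hierarchicalChain]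
  abel

theorem sum_axis {M : Type*} [AddCommMonoid M] (f : Axis → M) :
    ∑ u, f u = f Axis.x + (f Axis.y + f Axis.z) := by
  have : (Finset.univ : Finset Axis) = {Axis.x, Axis.y, Axis.z} := rfl
  rw [this, Finset.sum_insert (by decide), Finset.sum_insert (by decide), Finset.sum_singleton]

theorem exists_chainPieces_eq (hn : 0 < n) (T : Schedule n) {α : Fin n → Axis → Bool}
    {γ : Fin n → Axis → Axis → Bool} (hx : α ⟨0, hn⟩ Axis.x = true)
    (hz : α ⟨0, hn⟩ Axis.z = true) (hzz : γ ⟨0, hn⟩ Axis.z Axis.z = true) (R : Fin N → ℝ) :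
    ∃ x : EuclideanSpace ℝ (ChainIdx n N),
      ∑ j, (duration T j 1 : ℂ) • chainPieces N α γ x j = hierarchicalChain N R := by
  set d := duration T ⟨0, hn⟩ 1 with hd
  have hd0 : d ≠ 0 := (duration_one_pos T _).ne'
  -- Only the first piece is switched on, with couplings divided by its duration `d`; its `x`, `z`
  -- and `zz` terms are the ones guaranteed to be present.
  let f : Fin n × Fin N × Axis → ℝ := fun p =>
    if p.1 = ⟨0, hn⟩ then
      if p.2.2 = Axis.x then R p.2.1 / d else if p.2.2 = Axis.z then 2 * R p.2.1 / d else 0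
    else 0
  let g : Fin n × Fin (N - 1) × Axis × Axis → ℝ := fun p =>
    if p.1 = ⟨0, hn⟩ ∧ p.2.2.1 = Axis.z ∧ p.2.2.2 = Axis.z then R (bondRight p.2.1) / d else 0
  refine ⟨WithLp.toLp 2 (Sum.elim f g), ?_⟩
  have hscale : ∀ (r : ℝ) (M : Op N), (d : ℂ) • ((r / d : ℝ) : ℂ) • M = (r : ℂ) • M := by
    intro r M
    rw [smul_smul, ← Complex.ofReal_mul, mul_div_cancel₀ _ hd0]
  rw [Finset.sum_eq_single ⟨0, hn⟩]
  · simp only [chainPieces, Sum.elim_inl, Sum.elim_inr, sum_axis, f, g, ← hd]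
    simp only [hx, hz, hzz, if_true, reduceCtorEq, if_false, and_false, and_true,
      Complex.ofReal_zero, ite_self, zero_smul, add_zero, zero_add, smul_add, Finset.smul_sum,
      hscale, Finset.sum_add_distrib, hierarchicalChain]
  · intro j _ hj
    simp [chainPieces, f, g, hj]
  · simp

end Floquet

theorem corollary2 :
    ∃ c : ℝ, 0 < c ∧
      (∀ N : ℕ, 1 ≤ N →
        MeasureTheory.volume {x : EuclideanSpace ℝ (Floquet.IsingIdx N) |
            Floquet.HasDTC c Floquet.halves (Floquet.isingPieces N x)} = 0 ∧
          ∀ x₀ : EuclideanSpace ℝ (Floquet.IsingIdx N),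
            Floquet.UnstableAt
              (fun x => Floquet.hamiltonian Floquet.halves (Floquet.isingPieces N x))
              (fun x => Floquet.HasDTC c Floquet.halves (Floquet.isingPieces N x)) x₀) ∧
      (∀ (n : ℕ) (hn : 0 < n) (T : Floquet.Schedule n)
        (α : Fin n → Floquet.Axis → Bool) (γ : Fin n → Floquet.Axis → Floquet.Axis → Bool),
        α ⟨0, hn⟩ Floquet.Axis.x = true → α ⟨0, hn⟩ Floquet.Axis.z = true →
        γ ⟨0, hn⟩ Floquet.Axis.z Floquet.Axis.z = true →
        ∀ N : ℕ, 1 ≤ N →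
          MeasureTheory.volume {x : EuclideanSpace ℝ (Floquet.ChainIdx n N) |
              Floquet.HasDTC c T (Floquet.chainPieces N α γ x)} = 0 ∧
            ∀ x₀ : EuclideanSpace ℝ (Floquet.ChainIdx n N),
              Floquet.UnstableAt
                (fun x => Floquet.hamiltonian T (Floquet.chainPieces N α γ x))
                (fun x => Floquet.HasDTC c T (Floquet.chainPieces N α γ x)) x₀) := by
  refine ⟨Floquet.resolutionRate, Floquet.resolutionRate_pos, fun N _ => ?_,
    fun n hn T α γ hx hz hzz N _ => ?_⟩
  · obtain ⟨R, hR⟩ := Floquet.exists_hierarchicalChain_sumNondegenerate N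
    obtain ⟨x₁, hx₁⟩ := Floquet.exists_isingPieces_eq R
    exact Floquet.hasDTC_null_and_unstable Floquet.halves Floquet.isingPieces_isLinearMap
      Floquet.isingPieces_isHermitian (hx₁.symm ▸ hR)
  · obtain ⟨R, hR⟩ := Floquet.exists_hierarchicalChain_sumNondegenerate N
    obtain ⟨x₁, hx₁⟩ := Floquet.exists_chainPieces_eq hn T hx hz hzz R
    exact Floquet.hasDTC_null_and_unstable T (Floquet.chainPieces_isLinearMap α γ)
      (Floquet.chainPieces_isHermitian α γ) (hx₁.symm ▸ hR)
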